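/- **Setting.** Let $T,\lambda,\gamma_I>0$, $0<\gamma_L\le\gamma_H<\infty$ and $x_C\in\mathbb R$. Let $N$ be a homogeneous Poisson process on $[0,T]$ with intensity $\lambda$ and let $Y_1,Y_2,\dots$ be i.i.d. a.s. positive random variables, independent of $N$, with law $F$ and $\mathbb E[Y^2]<\infty$ (where $Y\sim F$); let $N(ds,dy)$ be the random measure on $[0,T]\times(0,\infty)$ with an atom at (arrival time, size) of each claim. Let $G$ be a probability distribution on $[\gamma_L,\gamma_H]$. The set $\mathcal A_l$ of admissible coverages consists of the measurable functions $l(t,y)\ge 0$ with $\int_0^T\!\int l(t,y)^2\,dF(y)\,dt<\infty$; an admissible loading is a function $\xi:[\gamma_L,\gamma_H]\to[0,\infty)$. For a customer who reports $\tilde\gamma$ and uses the coverage $l$, the premium rate (expected-value principle) is $p_t(l;\tilde\gamma)=(1+\xi(\tilde\gamma))\lambda\int l(t,y)\,dF(y)$; customer and insurer have $$X_C^\gamma(t,l;\tilde\gamma)=x_C-\int_0^t p_s\,ds-\int_0^t\!\!\int (y-l(s,y))\,N(ds,dy),\qquad X_I^\gamma(t,l;\tilde\gamma)=\int_0^t p_s\,ds-\int_0^t\!\!\int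 l(s,y)\,N(ds,dy).$$ Write $U_a[X]=\mathbb E[X]-\frac a2\mathrm{Var}[X]$. The customer's problem is $V_C^\gamma(\tilde\gamma)=\sup_{l\in\mathcal A_l}U_\gamma[X_C^\gamma(T,l;\tilde\gamma)]$. Let $J(t,x,l)$ be the utility $U_\gamma$ of terminal surplus when the surplus at time $t$ is $x$. A coverage $\hat l\in\mathcal A_l$ is an equilibrium strategy if $\liminf_{\varepsilon\downarrow0}\varepsilon^{-1}\bigl(J(t,x,\hat l)-J(t,x,l^\varepsilon)\bigr)\ge0$ for all $(t,x)\in[0,T]\times\mathbb R$ and all functions $\bar l(y)$ for which the perturbation $l^\varepsilon$ ($=\bar l$ on $[t,t+\varepsilon)$, $=\hat l$ otherwise) is admissible for all small $\varepsilon$. Truth-telling means $\gamma\in\operatorname{argmax}_{\tilde\gamma\in[\gamma_L,\gamma_H]}V_C^\gamma(\tilde\gamma)$ for every $\gamma\in[\gamma_L,\gamma_H]$; its first-order condition is $\partial_{\tilde\gamma}V_C^\gamma(\tilde\gamma)|_{\tilde\gamma=\gamma}=0$ for every $\gamma\in[\gamma_L,\gamma_H]$ (one-sided at the end points). The insurer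 maximizes $\int U_{\gamma_I}[X_I^\gamma(T,\hat l^\gamma(\gamma);\gamma)]\,dG(\gamma)$ over all admissible $\xi(\cdot)$ that satisfy truth-telling, where $\hat l^\gamma(\gamma)$ solves the customer's problem for type $\gamma$ reporting $\gamma$. Finally let $$h(\xi)=\int_{\gamma_L}^{\gamma_H}\Bigl(\xi\,\mathbb E\bigl[(Y-\tfrac\xi\gamma)_+\bigr]-\tfrac{\gamma_I}2\mathbb E\bigl[(Y-\tfrac\xi\gamma)_+^2\bigr]\Bigr)\,dG(\gamma),\qquad \xi\ge0 .$$ **Theorem.** For every admissible loading and all $\gamma,\tilde\gamma\in[\gamma_L,\gamma_H]$, the solutions of the customer's problem are exactly the equilibrium strategies. If an admissible loading $\xi$ is differentiable, truth-telling implies the first-order condition, and the first-order condition implies $\xi'(\gamma)\,\mathbb E[(Y-\xi(\gamma)/\gamma)_+]=0$ for all $\gamma$; moreover it forces $\xi$ to be constant on the set of all types $\gamma$ that buy insurance, i.e. with $\mathbb E[(Y-\xi(\gamma)/\gamma)_+]>0$. The function $h$ has a maximizer on $[0,\infty)$ if and only if $h(\xi)\ge0$ for some $\xi\ge0$. Further: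 (1) For $\hat\xi\ge0$, the constant loading $\hat\xi$, with coverages $(y-\hat\xi/\gamma)_+$, solves the insurer's problem if and only if $\hat\xi\in\operatorname{argmax}_{\xi\ge0}h(\xi)$. For every $\hat\xi\in\operatorname{argmax}_{\xi\ge0}h(\xi)$: (2) the optimal menu is $\hat l(\gamma)=(y-\hat\xi/\gamma)_+$, $\hat p(\gamma)=(1+\hat\xi)\lambda\,\mathbb E[(Y-\hat\xi/\gamma)_+]$ for $\gamma\in[\gamma_L,\gamma_H]$: $\hat l(\gamma)$ solves the problem of customer $\gamma$ and is an equilibrium strategy, and $\hat p(\gamma)$ is its premium rate; (3) the insurer's optimal value is $\int U_{\gamma_I}[X_I^\gamma(T,\hat l(\gamma);\gamma)]\,dG(\gamma)=\lambda T\,h(\hat\xi)$, with square integrable $X_I^\gamma(T,\hat l(\gamma);\gamma)$ and a $G$-integrable integrand; (4) the menu is truth-telling: for every $\gamma\in[\gamma_L,\gamma_H]$ the function $\tilde\gamma\mapsto U_\gamma[X_C^\gamma(T,\hat l(\tilde\gamma);\tilde\gamma)]$ on $[\gamma_L,\gamma_H]$ (of square integrable surpluses) is maximal at $\tilde\gamma=\gamma$,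 and a maximizer $\tilde\gamma\ne\gamma$ can only occur if both contracts give no coverage, i.e. $\mathbb E[(Y-\hat\xi/\gamma)_+]=\mathbb E[(Y-\hat\xi/\tilde\gamma)_+]=0$. -/

import Mathlib

open MeasureTheory ProbabilityTheory Set Filter Topology

noncomputable section

/-- `N` is a homogeneous Poisson process on `[0, T]` with intensity `lam`: it starts at `0`, its
paths are a.s. nondecreasing and right-continuous, its increments are independent, and
`N t - N s` is Poisson distributed with parameter `lam * (t - s)`. Only the values of `N` at times
in `[0, T]` are constrained. -/
structure IsPoissonProcess {Ω : Type*} [MeasurableSpace Ω] (P : Measure Ω) (lam T : ℝ)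
    (N : ℝ → Ω → ℕ) : Prop where
  measurable : ∀ t ∈ Icc (0 : ℝ) T, Measurable (N t)
  zero : ∀ᵐ ω ∂P, N 0 ω = 0
  mono : ∀ᵐ ω ∂P, MonotoneOn (fun t => N t ω) (Icc 0 T)
  rightCont : ∀ᵐ ω ∂P, ∀ t ∈ Ico (0 : ℝ) T,
    ContinuousWithinAt (fun s => N s ω) (Icc t T) t
  indep : HasIndepIncrements (fun (t : Icc (0 : ℝ) T) ω => N t ω) P
  law : ∀ s t : ℝ, 0 ≤ s → s ≤ t → t ≤ T →
    P.map (fun ω => N t ω - N s ω) = poissonMeasure (lam * (t - s)).toNNReal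

/-- The arrival time of claim number `i` (claims are numbered from `0`), for the counting
process `N`. -/
def arrivalTime {Ω : Type*} (N : ℝ → Ω → ℕ) (i : ℕ) (ω : Ω) : ℝ :=
  sInf {s : ℝ | 0 ≤ s ∧ i < N s ω}

/-- The mean-variance utility `E[X] - (a / 2) Var[X]` with risk aversion `a`. -/
def meanVariance {Ω : Type*} [MeasurableSpace Ω] (P : Measure Ω) (a : ℝ) (X : Ω → ℝ) : ℝ :=
  (∫ ω, X ω ∂P) - a / 2 * variance X P

/-- The data of the insurance market: the probability `P`, the horizon `T`, the claim intensity
`lam`, the customer's initial surplus `xC`, the insurer's risk aversion `γI`, the interval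
`[γL, γH]` of the customer's possible risk aversions and its distribution `G`, the claim counting
process `N` and the claim sizes `Y 0, Y 1, …`. -/
structure Market (Ω : Type*) [MeasurableSpace Ω] where
  P : Measure Ω
  T : ℝ
  lam : ℝ
  xC : ℝ
  γI : ℝ
  γL : ℝ
  γH : ℝ
  G : Measure ℝ
  N : ℝ → Ω → ℕ
  Y : ℕ → Ω → ℝ

namespace Market

variable {Ω : Type*} [MeasurableSpace Ω]

/-- The standing assumptions: the Cramér–Lundberg model with square integrable positive claims, and
a distribution of the risk aversion that is carried by a compact interval of positive numbers. -/
structure Standing (M : Market Ω) : Prop where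
  prob : IsProbabilityMeasure M.P
  T_pos : 0 < M.T
  lam_pos : 0 < M.lam
  γI_pos : 0 < M.γI
  γL_pos : 0 < M.γL
  γL_le : M.γL ≤ M.γH
  probG : IsProbabilityMeasure M.G
  suppG : ∀ᵐ γ ∂M.G, γ ∈ Icc M.γL M.γH
  poisson : IsPoissonProcess M.P M.lam M.T M.N
  measurableY : ∀ i, Measurable (M.Y i)
  posY : ∀ i, ∀ᵐ ω ∂M.P, 0 < M.Y i ω
  indepY : iIndepFun M.Y M.P
  identY : ∀ i, IdentDistrib (M.Y i) (M.Y 0) M.P M.P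
  sqIntegrableY : MemLp (M.Y 0) 2 M.P
  indepNY : IndepFun (fun ω (t : Icc (0 : ℝ) M.T) => M.N t ω) (fun ω (i : ℕ) => M.Y i ω) M.P

/-- The distribution `F` of a single claim. -/
def claimLaw (M : Market Ω) : Measure ℝ := M.P.map (M.Y 0)

/-- `∫_{(t, u]} ∫ h(s, y) N(ds, dy)`: the sum of `h` over the arrival time and the size of all
claims that arrive in `(t, u]`, which are those with number `N t ≤ i < N u`. -/
def claimSum (M : Market Ω) (h : ℝ → ℝ → ℝ) (t u : ℝ) (ω : Ω) : ℝ :=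
  ∑ i ∈ Finset.Ico (M.N t ω) (M.N u ω), h (arrivalTime M.N i ω) (M.Y i ω)

/-- Admissible loss coverages `l(s, y)`: measurable, nonnegative and square integrable. -/
structure Admissible (M : Market Ω) (l : ℝ → ℝ → ℝ) : Prop where
  measurable : Measurable (Function.uncurry l)
  nonneg : ∀ s ∈ Icc (0 : ℝ) M.T, ∀ y > 0, 0 ≤ l s y
  sqIntegrable : MemLp (Function.uncurry l) 2 ((volume.restrict (Icc (0 : ℝ) M.T)).prod M.claimLaw)

/-- The admissible loading functions. -/
def AdmissibleLoading (M : Market Ω) (ξ : ℝ → ℝ) : Prop :=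
  ∀ γ ∈ Icc M.γL M.γH, 0 ≤ ξ γ

/-- The premium rate at time `s` under the expected-value principle, for the coverage `l` and the
reported risk aversion `γ'`. -/
def premiumRate (M : Market Ω) (ξ : ℝ → ℝ) (γ' : ℝ) (l : ℝ → ℝ → ℝ) (s : ℝ) : ℝ :=
  (1 + ξ γ') * M.lam * ∫ y, l s y ∂M.claimLaw

/-- The customer's surplus at time `u`, with value `x` at time `t`, under the contract type `γ'`
and the coverage `l`. -/
def customerSurplus (M : Market Ω) (ξ : ℝ → ℝ) (γ' : ℝ) (l : ℝ → ℝ → ℝ) (t x u : ℝ) (ω : Ω) : ℝ :=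
  x - (∫ s in t..u, M.premiumRate ξ γ' l s) - M.claimSum (fun s y => y - l s y) t u ω

/-- The insurer's wealth at time `u` under the contract type `γ'` and the coverage `l`. -/
def insurerWealth (M : Market Ω) (ξ : ℝ → ℝ) (γ' : ℝ) (l : ℝ → ℝ → ℝ) (u : ℝ) (ω : Ω) : ℝ :=
  (∫ s in (0 : ℝ)..u, M.premiumRate ξ γ' l s) - M.claimSum l 0 u ω

/-- The mean-variance utility `J(t, x, l; γ')` of terminal surplus for a customer with true risk
aversion `γ` and contract type `γ'` whose surplus at time `t` is `x`. -/
def customerUtility (M : Market Ω) (ξ : ℝ → ℝ) (γ γ' t x : ℝ) (l : ℝ → ℝ → ℝ) : ℝ :=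
  meanVariance M.P γ (M.customerSurplus ξ γ' l t x M.T)

/-- The customer's value function `V_C^γ(γ')`. -/
def customerValue (M : Market Ω) (ξ : ℝ → ℝ) (γ γ' : ℝ) : ℝ :=
  ⨆ l : {l : ℝ → ℝ → ℝ // M.Admissible l}, M.customerUtility ξ γ γ' 0 M.xC l

/-- `l` solves the customer's problem: it attains the supremum that defines `V_C^γ(γ')`. -/
def IsOptimalCoverage (M : Market Ω) (ξ : ℝ → ℝ) (γ γ' : ℝ) (l : ℝ → ℝ → ℝ) : Prop :=
  M.Admissible l ∧ IsMaxOn (M.customerUtility ξ γ γ' 0 M.xC) {l' | M.Admissible l'} l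

/-- The strategy that uses `lbar` on `[t, t + ε)` and `l` otherwise. -/
def perturbed (l : ℝ → ℝ → ℝ) (lbar : ℝ → ℝ) (t ε : ℝ) : ℝ → ℝ → ℝ :=
  open Classical in fun s y => if s ∈ Ico t (t + ε) then lbar y else l s y

/-- `l` is an equilibrium strategy of the dynamic mean-variance problem. -/
def IsEquilibrium (M : Market Ω) (ξ : ℝ → ℝ) (γ γ' : ℝ) (l : ℝ → ℝ → ℝ) : Prop :=
  M.Admissible l ∧ ∀ t ∈ Icc (0 : ℝ) M.T, ∀ (x : ℝ) (lbar : ℝ → ℝ),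
    (∀ᶠ ε in 𝓝[>] (0 : ℝ), M.Admissible (perturbed l lbar t ε)) →
    0 ≤ liminf (fun ε : ℝ =>
      (((M.customerUtility ξ γ γ' t x l - M.customerUtility ξ γ γ' t x (perturbed l lbar t ε)) / ε
        : ℝ) : EReal)) (𝓝[>] 0)

/-- The truth-telling constraint: reporting the true risk aversion maximizes `V_C^γ`. -/
def TruthTelling (M : Market Ω) (ξ : ℝ → ℝ) : Prop :=
  ∀ γ ∈ Icc M.γL M.γH, IsMaxOn (M.customerValue ξ γ) (Icc M.γL M.γH) γ

/-- The first-order condition of the truth-telling constraint. -/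
def TruthTellingFOC (M : Market Ω) (ξ : ℝ → ℝ) : Prop :=
  ∀ γ ∈ Icc M.γL M.γH, HasDerivWithinAt (M.customerValue ξ γ) 0 (Icc M.γL M.γH) γ

/-- A menu, given by a loading function `ξ` and the coverages `L γ` that the types `γ` choose, is
feasible in the insurer's problem: the loading is admissible, `L γ` is the optimal response of
type `γ` to its own contract, and truth-telling holds. -/
structure IsFeasibleMenu (M : Market Ω) (ξ : ℝ → ℝ) (L : ℝ → ℝ → ℝ → ℝ) : Prop where
  loading : M.AdmissibleLoading ξ
  response : ∀ γ ∈ Icc M.γL M.γH, M.IsOptimalCoverage ξ γ γ (L γ)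
  truthful : M.TruthTelling ξ

/-- The insurer's objective: her mean-variance utility, averaged over the customer's types. -/
def insurerObjective (M : Market Ω) (ξ : ℝ → ℝ) (L : ℝ → ℝ → ℝ → ℝ) : ℝ :=
  ∫ γ in Icc M.γL M.γH, meanVariance M.P M.γI (M.insurerWealth ξ γ (L γ) M.T) ∂M.G

/-- The menu `(ξ, L)` solves the insurer's problem, among all feasible menus. -/
def IsOptimalMenu (M : Market Ω) (ξ : ℝ → ℝ) (L : ℝ → ℝ → ℝ → ℝ) : Prop :=
  M.IsFeasibleMenu ξ L ∧
    ∀ ξ' L', M.IsFeasibleMenu ξ' L' → M.insurerObjective ξ' L' ≤ M.insurerObjective ξ L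

/-- `E[(Y - d)_+]`. -/
def stopLoss (M : Market Ω) (d : ℝ) : ℝ := ∫ ω, max (M.Y 0 ω - d) 0 ∂M.P

/-- `E[(Y - d)_+²]`. -/
def stopLossSq (M : Market Ω) (d : ℝ) : ℝ := ∫ ω, (max (M.Y 0 ω - d) 0) ^ 2 ∂M.P

/-- `∫ (c E[(Y - c/γ)_+] - (γI / 2) E[(Y - c/γ)_+²]) dG(γ)`, as a function of the loading `c`. -/
def loadingCriterion (M : Market Ω) (c : ℝ) : ℝ :=
  ∫ γ in Icc M.γL M.γH, (c * M.stopLoss (c / γ) - M.γI / 2 * M.stopLossSq (c / γ)) ∂M.G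

end Market

/-- The excess-of-loss coverages `(y - c/γ)_+`, indexed by the type `γ`. -/
def excessOfLoss (c : ℝ) (γ : ℝ) : ℝ → ℝ → ℝ := fun _ y => max (y - c / γ) 0

end

/-!
The mean and the variance of a sum over the claims of a compound Poisson process are integrals
(Campbell's formulas), so the customer's mean-variance utility is itself an integral over time and
claim size, with integrand `coverageCost` up to sign and constants. It can therefore be maximized
claim by claim: `(y - θ/γ)_+` is optimal for the loading `θ`, and it is the only optimal coverage
up to null sets because the integrand is uniformly convex in the coverage. This pointwise structure
is also why optimal coverages and equilibrium strategies coincide: a deviation on `[t, t + ε)`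
changes the utility by an integral over that interval, and Lebesgue's differentiation theorem
recovers the pointwise optimality from the equilibrium condition.

Campbell's formulas are derived from the joint law of at most two increments of `N`. The first and second
factorial moment measures of the claim times are identified on the `π`-systems of half-lines and of
products of half-lines (`sum_map_claimTime`, `sum_map_claimTime_prod`), where they are moments of
`N a` and `(N a, N b)`. Independence of the claim sizes then gives `lintegral_tsum_claim` and
`lintegral_tsum_claim_sq` for nonnegative functions, and the parallelogram law gives
`claimSum_moments` for signed ones.

The customer's value depends on the report only through the loading `θ`, as a nonincreasing function
with derivative proportional to `-E[(Y - θ/γ)_+]` (`hasDerivAt_expectedCost`). Hence a truth-telling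
loading takes its minimum at every type that buys insurance. A type that does not buy has no demand
at this minimum either, since otherwise she would misreport. So the insurer earns the same as with
a constant loading, or nothing (`insurerObjective_eq_const_or_zero`), and her problem reduces to
maximizing `loadingCriterion`. This criterion is continuous, negative at zero and tends to zero at
infinity, which settles the existence of a maximizer and shows that a maximizer is positive.
-/

/-! ### Factorial moments of the Poisson distribution -/

/-- The Chen–Stein identity of the Poisson distribution, which yields all its factorial moments. -/
theorem lintegral_natCast_mul_poissonMeasure (r : NNReal) (f : ℕ → ENNReal) :
    ∫⁻ n, (n : ENNReal) * f n ∂(poissonMeasure r) = r * ∫⁻ n, f (n + 1) ∂(poissonMeasure r) := by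
  simp only [poissonMeasure, lintegral_sum_measure, lintegral_smul_measure, lintegral_dirac]
  rw [← ENNReal.tsum_mul_left]
  refine (tsum_eq_zero_add' ENNReal.summable).trans ?_
  simp only [Nat.cast_zero, zero_mul, mul_zero, zero_add, smul_eq_mul]
  refine tsum_congr fun n => ?_
  rw [← mul_assoc, ← mul_assoc]
  congr 1
  rw [← ENNReal.ofReal_natCast, ← ENNReal.ofReal_mul (by positivity),
    ← ENNReal.ofReal_coe_nnreal, ← ENNReal.ofReal_mul (by positivity)]
  congr 1
  rw [Nat.factorial_succ]
  push_cast
  field_simp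
  ring

theorem lintegral_natCast_poissonMeasure (r : NNReal) :
    ∫⁻ n, (n : ENNReal) ∂(poissonMeasure r) = r := by
  simpa using lintegral_natCast_mul_poissonMeasure r fun _ => 1

theorem lintegral_natCast_mul_pred_poissonMeasure (r : NNReal) :
    ∫⁻ n, (n : ENNReal) * ((n - 1 : ℕ) : ENNReal) ∂(poissonMeasure r) = (r : ENNReal) * r := by
  rw [lintegral_natCast_mul_poissonMeasure r fun n => ((n - 1 : ℕ) : ENNReal)]
  simp only [Nat.add_sub_cancel, lintegral_natCast_poissonMeasure]

/-! ### Arrival times -/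

/-- The first time at which the path `n` on `[0, T]` exceeds `i`, and `T + 1` if there is none.
The infimum runs over countably many times (the rationals, clamped to `[0, T]`), so that it is a
measurable function of the path. -/
noncomputable def firstExceedance {T : ℝ} (hT : 0 ≤ T) (i : ℕ) (n : Icc (0 : ℝ) T → ℕ) : ℝ :=
  ⨅ q : ℚ, if i < n (projIcc 0 T hT q) then (projIcc 0 T hT q : ℝ) else T + 1

section FirstExceedance

variable {T : ℝ} (hT : 0 ≤ T)

theorem measurable_firstExceedance (i : ℕ) : Measurable (firstExceedance hT i) := by
  unfold firstExceedance
  refine Measurable.iInf fun q => ?_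
  refine Measurable.ite ?_ measurable_const measurable_const
  exact measurableSet_lt measurable_const (measurable_pi_apply _)

theorem firstExceedance_bddBelow (i : ℕ) (n : Icc (0 : ℝ) T → ℕ) :
    BddBelow (range fun q : ℚ =>
      if i < n (projIcc 0 T hT q) then (projIcc 0 T hT q : ℝ) else T + 1) := by
  refine ⟨0, ?_⟩
  rintro _ ⟨q, rfl⟩
  dsimp only
  split_ifs
  · exact (projIcc 0 T hT q).2.1
  · linarith

theorem firstExceedance_nonneg (i : ℕ) (n : Icc (0 : ℝ) T → ℕ) : 0 ≤ firstExceedance hT i n := by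
  refine le_ciInf fun q => ?_
  split_ifs
  · exact (projIcc 0 T hT q).2.1
  · linarith

variable {n : ℝ → ℕ} {i : ℕ}

theorem firstExceedance_le_of_rat {q : ℚ} (hq : (q : ℝ) ∈ Icc 0 T) (hi : i < n q) :
    firstExceedance hT i (fun t => n t) ≤ q := by
  refine (ciInf_le (firstExceedance_bddBelow hT i fun t => n t) q).trans ?_
  rw [projIcc_of_mem hT hq, if_pos hi]

theorem firstExceedance_le_end (hi : i < n T) : firstExceedance hT i (fun t => n t) ≤ T := by
  obtain ⟨q, hq⟩ := exists_rat_gt T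
  refine (ciInf_le (firstExceedance_bddBelow hT i fun t => n t) q).trans ?_
  rw [projIcc_of_right_le hT hq.le, if_pos hi]

theorem sInf_eq_firstExceedance (hmono : MonotoneOn n (Icc 0 T)) (hi : i < n T) :
    sInf {s : ℝ | 0 ≤ s ∧ i < n s} = firstExceedance hT i (fun t => n t) := by
  have hbdd : BddBelow {s : ℝ | 0 ≤ s ∧ i < n s} := ⟨0, fun s hs => hs.1⟩
  apply le_antisymm
  · refine le_ciInf fun q => ?_
    split_ifs with h
    · exact csInf_le hbdd ⟨(projIcc 0 T hT q).2.1, h⟩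
    · exact (csInf_le hbdd ⟨hT, hi⟩).trans (by linarith)
  · refine le_csInf ⟨T, hT, hi⟩ ?_
    rintro s ⟨hs0, hs⟩
    rcases le_or_gt T s with hTs | hsT
    · exact (firstExceedance_le_end hT hi).trans hTs
    · refine le_of_forall_gt_imp_ge_of_dense fun b hb => ?_
      obtain ⟨q, hsq, hq⟩ := exists_rat_btwn (lt_min hb hsT)
      have hqT : (q : ℝ) ∈ Icc 0 T := ⟨hs0.trans hsq.le, (hq.trans_le (min_le_right _ _)).le⟩
      have hiq : i < n q := hs.trans_le (hmono ⟨hs0, hsT.le⟩ hqT hsq.le)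
      exact (firstExceedance_le_of_rat hT hqT hiq).trans (hq.trans_le (min_le_left _ _)).le

/-- By right-continuity, the path exceeds `i` at the first exceedance time itself. -/
theorem firstExceedance_le_iff (hmono : MonotoneOn n (Icc 0 T))
    (hright : ∀ t ∈ Ico (0 : ℝ) T, ContinuousWithinAt n (Icc t T) t) {a : ℝ} (ha : a ∈ Icc 0 T) :
    firstExceedance hT i (fun t => n t) ≤ a ↔ i < n a := by
  have hTT : T ∈ Icc 0 T := ⟨hT, le_rfl⟩
  constructor
  · contrapose!
    intro hi
    rcases ha.2.eq_or_lt with rfl | haT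
    · refine (lt_add_one a).trans_le (le_ciInf fun q => ?_)
      rw [if_neg]
      have hq := (projIcc 0 a hT q).2
      exact not_lt.2 ((hmono hq hTT hq.2).trans hi)
    · have hev : ∀ᶠ s in 𝓝[Icc a T] a, n s = n a :=
        (hright a ⟨ha.1, haT⟩).eventually ((isOpen_discrete {n a}).mem_nhds rfl)
      rw [eventually_nhdsWithin_iff, Metric.eventually_nhds_iff] at hev
      obtain ⟨δ, hδ, h⟩ := hev
      refine (lt_min (lt_add_of_pos_right a hδ) (haT.trans (lt_add_one T))).trans_le
        (le_ciInf fun q => ?_)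
      split_ifs with hq
      · refine (min_le_left _ _).trans (not_lt.1 fun hlt => ?_)
        have hqm := (projIcc 0 T hT q).2
        rcases le_total (projIcc 0 T hT q : ℝ) a with hle | hle
        · exact absurd (hq.trans_le (hmono hqm ha hle)) (not_lt.2 hi)
        · have := h (y := (projIcc 0 T hT q : ℝ))
            (by rw [Real.dist_eq, abs_of_nonneg (by linarith)]; linarith) ⟨hle, hqm.2⟩
          simp only at hq
          omega
      · exact min_le_right _ _
  · intro hi
    rw [← sInf_eq_firstExceedance hT hmono (hi.trans_le (hmono ha hTT ha.2))]
    exact csInf_le ⟨0, fun s hs => hs.1⟩ ⟨ha.1, hi⟩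

end FirstExceedance

/-! ### Factorial moment measures of the claim times -/

/-- The time of claim number `i`, as a measurable function of the path of the counting process `N`
on `[0, T]`, with the value `T + 1` if the claim does not arrive by time `T`. -/
noncomputable def claimTime {Ω : Type*} {T : ℝ} (hT : 0 ≤ T) (N : ℝ → Ω → ℕ) (i : ℕ) (ω : Ω) : ℝ :=
  firstExceedance hT i fun t => N t ω

theorem tsum_ite_lt (n : ℕ) : ∑' i : ℕ, (if i < n then 1 else 0 : ENNReal) = n := by
  rw [tsum_eq_sum (s := Finset.range n)]
  · rw [Finset.sum_congr rfl fun i hi => if_pos (Finset.mem_range.1 hi)]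
    simp
  · intro i hi
    rw [if_neg (by simpa using hi)]

theorem tsum_ite_ne_lt {m n : ℕ} (h : m ≤ n) :
    ∑' p : ℕ × ℕ, (if p.1 ≠ p.2 ∧ p.1 < m ∧ p.2 < n then 1 else 0 : ENNReal)
      = m * ((n - 1 : ℕ) : ENNReal) := by
  rw [ENNReal.tsum_prod', ← tsum_ite_lt m, ← ENNReal.tsum_mul_right]
  refine tsum_congr fun i => ?_
  by_cases hi : i < m
  · rw [if_pos hi, one_mul, tsum_eq_sum (s := (Finset.range n).erase i)]
    · rw [Finset.sum_congr rfl fun j hj => if_pos ?_]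
      · rw [Finset.sum_const, Finset.card_erase_of_mem (Finset.mem_range.2 (hi.trans_le h))]
        simp
      · rw [Finset.mem_erase, Finset.mem_range] at hj
        exact ⟨hj.1.symm, hi, hj.2⟩
    · intro j hj
      rw [if_neg]
      rintro ⟨h1, -, h2⟩
      exact hj (Finset.mem_erase.2 ⟨h1.symm, Finset.mem_range.2 h2⟩)
  · simp [hi]

namespace IsPoissonProcess

variable {Ω : Type*} [MeasurableSpace Ω] {P : Measure Ω} {lam T : ℝ} {N : ℝ → Ω → ℕ}

theorem measurable_path (h : IsPoissonProcess P lam T N) :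
    Measurable fun ω (t : Icc (0 : ℝ) T) => N t ω :=
  measurable_pi_iff.2 fun t => h.measurable t t.2

theorem measurable_claimTime (h : IsPoissonProcess P lam T N) (hT : 0 ≤ T) (i : ℕ) :
    Measurable (claimTime hT N i) :=
  (measurable_firstExceedance hT i).comp h.measurable_path

theorem claimTime_le_iff (h : IsPoissonProcess P lam T N) (hT : 0 ≤ T) :
    ∀ᵐ ω ∂P, ∀ i : ℕ, ∀ a ∈ Icc 0 T, claimTime hT N i ω ≤ a ↔ i < N a ω := by
  filter_upwards [h.mono, h.rightCont] with ω hm hr i a ha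
  exact firstExceedance_le_iff hT (n := fun t => N t ω) hm hr ha

theorem arrivalTime_eq_claimTime (h : IsPoissonProcess P lam T N) (hT : 0 ≤ T) :
    ∀ᵐ ω ∂P, ∀ i : ℕ, i < N T ω → arrivalTime N i ω = claimTime hT N i ω := by
  filter_upwards [h.mono] with ω hm i hi
  exact sInf_eq_firstExceedance hT (n := fun t => N t ω) hm hi

theorem lintegral_sub (h : IsPoissonProcess P lam T N) {s t : ℝ} (hs : 0 ≤ s) (hst : s ≤ t)
    (ht : t ≤ T) :
    ∫⁻ ω, ((N t ω - N s ω : ℕ) : ENNReal) ∂P = ENNReal.ofReal (lam * (t - s)) := by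
  have hm : Measurable fun ω => N t ω - N s ω :=
    (h.measurable t ⟨hs.trans hst, ht⟩).sub (h.measurable s ⟨hs, hst.trans ht⟩)
  rw [← lintegral_map (f := fun n : ℕ => (n : ENNReal)) (by fun_prop) hm, h.law s t hs hst ht,
    lintegral_natCast_poissonMeasure]
  rfl

theorem lintegral_count (h : IsPoissonProcess P lam T N) {a : ℝ} (ha : a ∈ Icc 0 T) :
    ∫⁻ ω, (N a ω : ENNReal) ∂P = ENNReal.ofReal (lam * a) := by
  rw [← sub_zero a, ← h.lintegral_sub le_rfl ha.1 ha.2, sub_zero]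
  refine lintegral_congr_ae ?_
  filter_upwards [h.zero] with ω h0
  simp [h0]

theorem lintegral_count_mul_pred (h : IsPoissonProcess P lam T N) {a : ℝ} (ha : a ∈ Icc 0 T) :
    ∫⁻ ω, (N a ω : ENNReal) * ((N a ω - 1 : ℕ) : ENNReal) ∂P
      = ENNReal.ofReal (lam * a) * ENNReal.ofReal (lam * a) := by
  have hm : Measurable fun ω => N a ω - N 0 ω :=
    (h.measurable a ha).sub (h.measurable 0 ⟨le_rfl, ha.1.trans ha.2⟩)
  have hlaw := h.law 0 a le_rfl ha.1 ha.2
  rw [sub_zero] at hlaw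
  change _ = (((lam * a).toNNReal : NNReal) : ENNReal) * (((lam * a).toNNReal : NNReal) : ENNReal)
  rw [← lintegral_natCast_mul_pred_poissonMeasure, ← hlaw, lintegral_map (by fun_prop) hm]
  refine lintegral_congr_ae ?_
  filter_upwards [h.zero] with ω h0
  simp [h0]

/-- The mixed second factorial moment of the counts up to two times. -/
theorem lintegral_count_mul_count_pred (h : IsPoissonProcess P lam T N) (hlam : 0 ≤ lam) {a b : ℝ}
    (ha : 0 ≤ a) (hab : a ≤ b) (hb : b ≤ T) :
    ∫⁻ ω, (N a ω : ENNReal) * ((N b ω - 1 : ℕ) : ENNReal) ∂P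
      = ENNReal.ofReal (lam * a) * ENNReal.ofReal (lam * b) := by
  have ha' : a ∈ Icc 0 T := ⟨ha, hab.trans hb⟩
  have hb' : b ∈ Icc 0 T := ⟨ha.trans hab, hb⟩
  have h0' : (0 : ℝ) ∈ Icc 0 T := ⟨le_rfl, ha.trans (hab.trans hb)⟩
  have hNa := h.measurable a ha'
  have hNb := h.measurable b hb'
  have hN0 := h.measurable 0 h0'
  have hind : IndepFun (fun ω => N a ω - N 0 ω) (fun ω => N b ω - N a ω) P :=
    h.indep.indepFun_sub_sub (r := ⟨0, h0'⟩) (s := ⟨a, ha'⟩) (t := ⟨b, hb'⟩) ha hab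
  have hsplit : ∀ᵐ ω ∂P, (N a ω : ENNReal) * ((N b ω - 1 : ℕ) : ENNReal)
      = (N a ω : ENNReal) * ((N a ω - 1 : ℕ) : ENNReal)
        + ((N a ω - N 0 ω : ℕ) : ENNReal) * ((N b ω - N a ω : ℕ) : ENNReal) := by
    filter_upwards [h.zero, h.mono] with ω h0 hm
    have hle : N a ω ≤ N b ω := hm ha' hb' hab
    rw [h0]
    norm_cast
    rcases Nat.eq_zero_or_pos (N a ω) with hz | hpos
    · simp [hz]
    · rw [Nat.sub_zero, ← mul_add]
      congr 1
      omega
  rw [lintegral_congr_ae hsplit, lintegral_add_left (by fun_prop), h.lintegral_count_mul_pred ha']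
  have hprod := lintegral_mul_eq_lintegral_mul_lintegral_of_indepFun
    (f := fun ω => ((N a ω - N 0 ω : ℕ) : ENNReal)) (g := fun ω => ((N b ω - N a ω : ℕ) : ENNReal))
    (μ := P) (by fun_prop) (by fun_prop)
    (hind.comp (φ := fun n : ℕ => (n : ENNReal)) (ψ := fun n : ℕ => (n : ENNReal))
      (by fun_prop) (by fun_prop))
  simp only [Pi.mul_apply] at hprod
  rw [hprod, h.lintegral_sub le_rfl ha ha'.2, h.lintegral_sub ha hab hb, sub_zero, ← mul_add,
    ← ENNReal.ofReal_add (by positivity) (mul_nonneg hlam (by linarith))]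
  congr 2
  ring

theorem tsum_measure_claimTime_le (h : IsPoissonProcess P lam T N) (hT : 0 ≤ T) {a : ℝ}
    (ha : a ∈ Icc 0 T) :
    ∑' i, P {ω | claimTime hT N i ω ≤ a} = ENNReal.ofReal (lam * a) := by
  have hNa := h.measurable a ha
  have hset : ∀ i : ℕ, MeasurableSet {ω | i < N a ω} := fun i => measurableSet_lt (by fun_prop) hNa
  rw [← h.lintegral_count ha]
  calc ∑' i, P {ω | claimTime hT N i ω ≤ a} = ∑' i : ℕ, P {ω | i < N a ω} := by
        refine tsum_congr fun i => measure_congr ?_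
        filter_upwards [h.claimTime_le_iff hT] with ω hω
        exact propext (hω i a ha)
    _ = ∑' i : ℕ, ∫⁻ ω, (if i < N a ω then 1 else 0) ∂P := by
        refine tsum_congr fun i => ?_
        rw [← lintegral_indicator_one (hset i)]
        refine lintegral_congr fun ω => ?_
        simp [indicator_apply]
    _ = ∫⁻ ω, (N a ω : ENNReal) ∂P := by
        rw [← lintegral_tsum fun i =>
          (Measurable.ite (hset i) measurable_const measurable_const).aemeasurable]
        simp only [tsum_ite_lt]

theorem tsum_measure_claimTime_le_and_le (h : IsPoissonProcess P lam T N) (hlam : 0 ≤ lam)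
    (hT : 0 ≤ T) {a b : ℝ} (ha : a ∈ Icc 0 T) (hb : b ∈ Icc 0 T) :
    ∑' p : ℕ × ℕ, (if p.1 ≠ p.2 then
        P {ω | claimTime hT N p.1 ω ≤ a ∧ claimTime hT N p.2 ω ≤ b} else 0)
      = ENNReal.ofReal (lam * a) * ENNReal.ofReal (lam * b) := by
  wlog hab : a ≤ b generalizing a b
  · rw [mul_comm, ← this hb ha (le_of_not_ge hab), ← (Equiv.prodComm ℕ ℕ).tsum_eq]
    simp only [Equiv.prodComm_apply, Prod.fst_swap, Prod.snd_swap, ne_comm, and_comm]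
  have hNa := h.measurable a ha
  have hNb := h.measurable b hb
  have hset : ∀ p : ℕ × ℕ, MeasurableSet {ω | p.1 ≠ p.2 ∧ p.1 < N a ω ∧ p.2 < N b ω} := fun p =>
    (MeasurableSet.const _).inter
      ((measurableSet_lt (by fun_prop) hNa).inter (measurableSet_lt (by fun_prop) hNb))
  rw [← h.lintegral_count_mul_count_pred hlam ha.1 hab hb.2]
  calc _ = ∑' p : ℕ × ℕ, P {ω | p.1 ≠ p.2 ∧ p.1 < N a ω ∧ p.2 < N b ω} := by
        refine tsum_congr fun p => ?_
        split_ifs with hp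
        · refine measure_congr ?_
          filter_upwards [h.claimTime_le_iff hT] with ω hω
          refine propext ⟨fun h' => ⟨hp, (hω _ a ha).1 h'.1, (hω _ b hb).1 h'.2⟩,
            fun h' => ⟨(hω _ a ha).2 h'.2.1, (hω _ b hb).2 h'.2.2⟩⟩
        · simp [hp]
    _ = ∑' p : ℕ × ℕ, ∫⁻ ω, (if p.1 ≠ p.2 ∧ p.1 < N a ω ∧ p.2 < N b ω then 1 else 0) ∂P := by
        refine tsum_congr fun p => ?_
        rw [← lintegral_indicator_one (hset p)]
        refine lintegral_congr fun ω => ?_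
        simp [indicator_apply]
    _ = ∫⁻ ω, (N a ω : ENNReal) * ((N b ω - 1 : ℕ) : ENNReal) ∂P := by
        rw [← lintegral_tsum fun p =>
          (Measurable.ite (hset p) measurable_const measurable_const).aemeasurable]
        refine lintegral_congr_ae ?_
        filter_upwards [h.mono] with ω hm
        exact tsum_ite_ne_lt (hm ha hb hab)

/-- The intensity measure of the claim times on `(0, T]` is `lam` times Lebesgue measure. -/
theorem sum_map_claimTime (h : IsPoissonProcess P lam T N) (hlam : 0 ≤ lam) (hT : 0 ≤ T) :
    Measure.sum (fun i => (P.map (claimTime hT N i)).restrict (Iic T))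
      = ENNReal.ofReal lam • volume.restrict (Ioc 0 T) := by
  have hfin : IsFiniteMeasure (ENNReal.ofReal lam • volume.restrict (Ioc 0 T)) :=
    Measure.smul_finite _ ENNReal.ofReal_ne_top
  refine (Measure.ext_of_Iic _ _ fun a => ?_).symm
  have hset : Iic a ∩ Ioc 0 T = Ioc 0 (min a T) := by
    ext s
    simp only [mem_inter_iff, mem_Iic, mem_Ioc, le_min_iff]
    tauto
  rw [Measure.sum_apply _ measurableSet_Iic, Measure.smul_apply,
    Measure.restrict_apply measurableSet_Iic, hset, Real.volume_Ioc, sub_zero, smul_eq_mul,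
    ← ENNReal.ofReal_mul hlam]
  have hi : ∀ i, (P.map (claimTime hT N i)).restrict (Iic T) (Iic a)
      = P {ω | claimTime hT N i ω ≤ min a T} := fun i => by
    rw [Measure.restrict_apply measurableSet_Iic, Iic_inter_Iic,
      Measure.map_apply (h.measurable_claimTime hT i) measurableSet_Iic]
    rfl
  simp only [hi]
  rcases lt_or_ge (min a T) 0 with hneg | hpos
  · rw [ENNReal.ofReal_of_nonpos (mul_nonpos_of_nonneg_of_nonpos hlam hneg.le), eq_comm,
      ENNReal.tsum_eq_zero]
    intro i
    convert measure_empty (μ := P)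
    refine eq_empty_of_forall_notMem fun ω hω => ?_
    exact absurd (firstExceedance_nonneg hT i fun t => N t ω) (not_le.2 (lt_of_le_of_lt hω hneg))
  · rw [h.tsum_measure_claimTime_le hT ⟨hpos, min_le_right _ _⟩]

/-- The second factorial moment measure of the claim times on `(0, T]` is the square of their
intensity measure. -/
theorem sum_map_claimTime_prod (h : IsPoissonProcess P lam T N) (hlam : 0 ≤ lam) (hT : 0 ≤ T) :
    Measure.sum (fun p : ℕ × ℕ => if p.1 ≠ p.2 then
        (P.map fun ω => (claimTime hT N p.1 ω, claimTime hT N p.2 ω)).restrict (Iic T ×ˢ Iic T)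
        else 0)
      = (ENNReal.ofReal lam • volume.restrict (Ioc 0 T)).prod
          (ENNReal.ofReal lam • volume.restrict (Ioc 0 T)) := by
  have hfin : IsFiniteMeasure (ENNReal.ofReal lam • volume.restrict (Ioc 0 T)) :=
    Measure.smul_finite _ ENNReal.ofReal_ne_top
  have hspan : (ENNReal.ofReal lam • volume.restrict (Ioc 0 T)).FiniteSpanningSetsIn
      (range (Iic : ℝ → Set ℝ)) :=
    { set := fun n => Iic (n : ℝ)
      set_mem := fun n => ⟨n, rfl⟩
      finite := fun n => measure_lt_top _ _
      spanning := by
        refine eq_univ_of_forall fun x => ?_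
        obtain ⟨n, hn⟩ := exists_nat_ge x
        exact mem_iUnion.2 ⟨n, hn⟩ }
  have hgen : MeasurableSpace.generateFrom (range (Iic : ℝ → Set ℝ)) = borel ℝ :=
    (borel_eq_generateFrom_Iic ℝ).symm
  refine (Measure.prod_eq_generateFrom hgen hgen isPiSystem_Iic isPiSystem_Iic hspan hspan ?_).symm
  rintro _ ⟨a, rfl⟩ _ ⟨b, rfl⟩
  have hset : ∀ a, Iic a ∩ Ioc 0 T = Ioc 0 (min a T) := fun a => by
    ext s
    simp only [mem_inter_iff, mem_Iic, mem_Ioc, le_min_iff]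
    tauto
  have hpair : ∀ p : ℕ × ℕ,
      Measurable fun ω => (claimTime hT N p.1 ω, claimTime hT N p.2 ω) := fun p =>
    (h.measurable_claimTime hT _).prodMk (h.measurable_claimTime hT _)
  simp only [Measure.smul_apply, Measure.restrict_apply measurableSet_Iic, hset, Real.volume_Ioc,
    sub_zero, smul_eq_mul]
  rw [Measure.sum_apply _ (measurableSet_Iic.prod measurableSet_Iic), ← ENNReal.ofReal_mul hlam,
    ← ENNReal.ofReal_mul hlam]
  have hp : ∀ p : ℕ × ℕ, (if p.1 ≠ p.2 then
        (P.map fun ω => (claimTime hT N p.1 ω, claimTime hT N p.2 ω)).restrict (Iic T ×ˢ Iic T)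
        else 0) (Iic a ×ˢ Iic b)
      = if p.1 ≠ p.2 then
          P {ω | claimTime hT N p.1 ω ≤ min a T ∧ claimTime hT N p.2 ω ≤ min b T} else 0 := by
    intro p
    split_ifs
    · rw [Measure.restrict_apply (measurableSet_Iic.prod measurableSet_Iic), prod_inter_prod,
        Iic_inter_Iic, Iic_inter_Iic,
        Measure.map_apply (hpair p) (measurableSet_Iic.prod measurableSet_Iic)]
      rfl
    · rfl
  simp only [hp]
  rcases lt_or_ge (min a T) 0 with hneg | hposa
  · rw [ENNReal.ofReal_of_nonpos (mul_nonpos_of_nonneg_of_nonpos hlam hneg.le), zero_mul,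
      ENNReal.tsum_eq_zero]
    intro p
    split_ifs
    · convert measure_empty (μ := P)
      refine eq_empty_of_forall_notMem fun ω hω => ?_
      exact absurd (firstExceedance_nonneg hT p.1 fun t => N t ω)
        (not_le.2 (lt_of_le_of_lt hω.1 hneg))
    · rfl
  rcases lt_or_ge (min b T) 0 with hneg | hposb
  · rw [ENNReal.ofReal_of_nonpos (mul_nonpos_of_nonneg_of_nonpos hlam hneg.le), mul_zero,
      ENNReal.tsum_eq_zero]
    intro p
    split_ifs
    · convert measure_empty (μ := P)
      refine eq_empty_of_forall_notMem fun ω hω => ?_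
      exact absurd (firstExceedance_nonneg hT p.2 fun t => N t ω)
        (not_le.2 (lt_of_le_of_lt hω.2 hneg))
    · rfl
  exact h.tsum_measure_claimTime_le_and_le hlam hT ⟨hposa, min_le_right _ _⟩
    ⟨hposb, min_le_right _ _⟩

theorem tsum_lintegral_claimTime (h : IsPoissonProcess P lam T N) (hlam : 0 ≤ lam) (hT : 0 ≤ T)
    {g : ℝ → ENNReal} (hg : Measurable g) :
    ∑' i, ∫⁻ ω, (Iic T).indicator g (claimTime hT N i ω) ∂P
      = ENNReal.ofReal lam * ∫⁻ s in Ioc 0 T, g s := by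
  rw [← smul_eq_mul, ← lintegral_smul_measure, ← h.sum_map_claimTime hlam hT,
    lintegral_sum_measure]
  refine tsum_congr fun i => ?_
  rw [← lintegral_indicator measurableSet_Iic,
    lintegral_map (hg.indicator measurableSet_Iic) (h.measurable_claimTime hT i)]

theorem tsum_lintegral_claimTime_mul (h : IsPoissonProcess P lam T N) (hlam : 0 ≤ lam)
    (hT : 0 ≤ T) {g : ℝ → ENNReal} (hg : Measurable g) :
    ∑' p : ℕ × ℕ, (if p.1 ≠ p.2 then ∫⁻ ω, (Iic T).indicator g (claimTime hT N p.1 ω)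
        * (Iic T).indicator g (claimTime hT N p.2 ω) ∂P else 0)
      = (ENNReal.ofReal lam * ∫⁻ s in Ioc 0 T, g s) ^ 2 := by
  have hfin : IsFiniteMeasure (ENNReal.ofReal lam • volume.restrict (Ioc 0 T)) :=
    Measure.smul_finite _ ENNReal.ofReal_ne_top
  rw [sq, ← smul_eq_mul (ENNReal.ofReal lam), ← lintegral_smul_measure,
    ← lintegral_prod_mul hg.aemeasurable hg.aemeasurable, ← h.sum_map_claimTime_prod hlam hT,
    lintegral_sum_measure]
  refine tsum_congr fun p => ?_
  split_ifs
  · have hm : Measurable fun z : ℝ × ℝ => (Iic T).indicator g z.1 * (Iic T).indicator g z.2 :=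
      ((hg.indicator measurableSet_Iic).comp measurable_fst).mul
        ((hg.indicator measurableSet_Iic).comp measurable_snd)
    rw [← lintegral_map hm
        ((h.measurable_claimTime hT _).prodMk (h.measurable_claimTime hT _)),
      ← lintegral_indicator (measurableSet_Iic.prod measurableSet_Iic)]
    refine lintegral_congr fun z => ?_
    by_cases h1 : z.1 ≤ T <;> by_cases h2 : z.2 ≤ T <;>
      simp [indicator, Prod.le_def, h1, h2]
  · exact (lintegral_zero_measure _).symm

end IsPoissonProcess

/-! ### Mean and variance of claim sums -/

namespace Market

variable {Ω : Type*} [MeasurableSpace Ω] {M : Market Ω}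

/-- The product `ds ⊗ F` on `(t, T] × ℝ`: the intensity measure, up to the factor `lam`, of the
claims that arrive in `(t, T]`. -/
noncomputable def lossMeasure (M : Market Ω) (t : ℝ) : Measure (ℝ × ℝ) :=
  (volume.restrict (Ioc t M.T)).prod M.claimLaw

namespace Standing

theorem isProbabilityMeasure_claimLaw (hM : M.Standing) : IsProbabilityMeasure M.claimLaw :=
  have := hM.prob
  Measure.isProbabilityMeasure_map (hM.measurableY 0).aemeasurable

theorem map_claim (hM : M.Standing) (i : ℕ) : M.P.map (M.Y i) = M.claimLaw :=
  (hM.identY i).map_eq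

theorem measurable_claim (hM : M.Standing) (i : ℕ) :
    Measurable fun ω => (claimTime hM.T_pos.le M.N i ω, M.Y i ω) :=
  (hM.poisson.measurable_claimTime _ i).prodMk (hM.measurableY i)

theorem measurable_comp_claim (hM : M.Standing) {f : ℝ × ℝ → ENNReal} (hf : Measurable f) (i : ℕ) :
    Measurable fun ω => f (claimTime hM.T_pos.le M.N i ω, M.Y i ω) :=
  hf.comp (hM.measurable_claim i)

/-- The size of a claim can be integrated out, given the claim time. -/
theorem lintegral_claim (hM : M.Standing) {f : ℝ × ℝ → ENNReal} (hf : Measurable f) (i : ℕ) :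
    ∫⁻ ω, f (claimTime hM.T_pos.le M.N i ω, M.Y i ω) ∂M.P
      = ∫⁻ ω, (∫⁻ y, f (claimTime hM.T_pos.le M.N i ω, y) ∂M.claimLaw) ∂M.P := by
  have := hM.prob
  have := hM.isProbabilityMeasure_claimLaw
  have hτ := hM.poisson.measurable_claimTime hM.T_pos.le i
  have hind : IndepFun (claimTime hM.T_pos.le M.N i) (M.Y i) M.P :=
    hM.indepNY.comp (measurable_firstExceedance hM.T_pos.le i) (measurable_pi_apply i)
  rw [← lintegral_map hf (hM.measurable_claim i),
    (indepFun_iff_map_prod_eq_prod_map_map hτ.aemeasurable (hM.measurableY i).aemeasurable).1 hind,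
    hM.map_claim, lintegral_prod _ hf.aemeasurable,
    lintegral_map hf.lintegral_prod_right' hτ]

/-- The sizes of two different claims can be integrated out, given the claim times. -/
theorem lintegral_claim_mul (hM : M.Standing) {f : ℝ × ℝ → ENNReal} (hf : Measurable f)
    {i j : ℕ} (hij : i ≠ j) :
    ∫⁻ ω, f (claimTime hM.T_pos.le M.N i ω, M.Y i ω)
        * f (claimTime hM.T_pos.le M.N j ω, M.Y j ω) ∂M.P
      = ∫⁻ ω, (∫⁻ y, f (claimTime hM.T_pos.le M.N i ω, y) ∂M.claimLaw)
        * (∫⁻ y, f (claimTime hM.T_pos.le M.N j ω, y) ∂M.claimLaw) ∂M.P := by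
  have := hM.prob
  have := hM.isProbabilityMeasure_claimLaw
  have hτ : Measurable fun ω =>
      (claimTime hM.T_pos.le M.N i ω, claimTime hM.T_pos.le M.N j ω) :=
    (hM.poisson.measurable_claimTime hM.T_pos.le i).prodMk
      (hM.poisson.measurable_claimTime hM.T_pos.le j)
  have hY : Measurable fun ω => (M.Y i ω, M.Y j ω) := (hM.measurableY i).prodMk (hM.measurableY j)
  have hind : IndepFun (fun ω => (claimTime hM.T_pos.le M.N i ω, claimTime hM.T_pos.le M.N j ω))
      (fun ω => (M.Y i ω, M.Y j ω)) M.P :=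
    hM.indepNY.comp (φ := fun n => (firstExceedance hM.T_pos.le i n,
        firstExceedance hM.T_pos.le j n)) (ψ := fun y : ℕ → ℝ => (y i, y j))
      ((measurable_firstExceedance hM.T_pos.le i).prodMk
        (measurable_firstExceedance hM.T_pos.le j))
      (Measurable.prodMk (measurable_pi_apply i) (measurable_pi_apply j))
  have hYmap : M.P.map (fun ω => (M.Y i ω, M.Y j ω)) = M.claimLaw.prod M.claimLaw := by
    rw [(indepFun_iff_map_prod_eq_prod_map_map (hM.measurableY i).aemeasurable
      (hM.measurableY j).aemeasurable).1 (hM.indepY.indepFun hij), hM.map_claim, hM.map_claim]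
  have hk : Measurable fun z : (ℝ × ℝ) × (ℝ × ℝ) => f (z.1.1, z.2.1) * f (z.1.2, z.2.2) := by
    fun_prop
  have hg : Measurable fun s => ∫⁻ y, f (s, y) ∂M.claimLaw := hf.lintegral_prod_right'
  calc _ = ∫⁻ z, f (z.1.1, z.2.1) * f (z.1.2, z.2.2) ∂(M.P.map fun ω =>
            ((claimTime hM.T_pos.le M.N i ω, claimTime hM.T_pos.le M.N j ω),
              (M.Y i ω, M.Y j ω))) := (lintegral_map hk (hτ.prodMk hY)).symm
    _ = ∫⁻ s, ∫⁻ y, f (s.1, y.1) * f (s.2, y.2) ∂(M.claimLaw.prod M.claimLaw)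
          ∂(M.P.map fun ω => (claimTime hM.T_pos.le M.N i ω, claimTime hM.T_pos.le M.N j ω)) := by
        rw [(indepFun_iff_map_prod_eq_prod_map_map hτ.aemeasurable hY.aemeasurable).1 hind, hYmap,
          lintegral_prod _ hk.aemeasurable]
    _ = ∫⁻ s, (∫⁻ y, f (s.1, y) ∂M.claimLaw) * (∫⁻ y, f (s.2, y) ∂M.claimLaw)
          ∂(M.P.map fun ω => (claimTime hM.T_pos.le M.N i ω, claimTime hM.T_pos.le M.N j ω)) := by
        refine lintegral_congr fun s => ?_
        exact lintegral_prod_mul (hf.comp measurable_prodMk_left).aemeasurable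
          (hf.comp measurable_prodMk_left).aemeasurable
    _ = _ := lintegral_map ((hg.comp measurable_fst).mul (hg.comp measurable_snd)) hτ

variable {f : ℝ × ℝ → ENNReal}

theorem indicator_Iic_lintegral (hf0 : ∀ s y, M.T < s → f (s, y) = 0) (s : ℝ) :
    (Iic M.T).indicator (fun s => ∫⁻ y, f (s, y) ∂M.claimLaw) s = ∫⁻ y, f (s, y) ∂M.claimLaw := by
  by_cases hs : s ≤ M.T
  · exact indicator_of_mem (mem_Iic.2 hs) _
  · rw [indicator_of_notMem (by simpa using hs)]
    simp [hf0 s _ (not_le.1 hs)]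

/-- Campbell's formula for the mean. -/
theorem lintegral_tsum_claim (hM : M.Standing) (hf : Measurable f)
    (hf0 : ∀ s y, M.T < s → f (s, y) = 0) :
    ∫⁻ ω, ∑' i, f (claimTime hM.T_pos.le M.N i ω, M.Y i ω) ∂M.P
      = ENNReal.ofReal M.lam * ∫⁻ z, f z ∂(M.lossMeasure 0) := by
  have := hM.isProbabilityMeasure_claimLaw
  rw [lintegral_tsum fun i => (hM.measurable_comp_claim hf i).aemeasurable, lossMeasure,
    lintegral_prod _ hf.aemeasurable,
    ← hM.poisson.tsum_lintegral_claimTime hM.lam_pos.le hM.T_pos.le hf.lintegral_prod_right']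
  simp only [indicator_Iic_lintegral hf0, hM.lintegral_claim hf]

/-- Campbell's formula for the second moment. -/
theorem lintegral_tsum_claim_sq (hM : M.Standing) (hf : Measurable f)
    (hf0 : ∀ s y, M.T < s → f (s, y) = 0) :
    ∫⁻ ω, (∑' i, f (claimTime hM.T_pos.le M.N i ω, M.Y i ω)) ^ 2 ∂M.P
      = ENNReal.ofReal M.lam * ∫⁻ z, f z ^ 2 ∂(M.lossMeasure 0)
        + (ENNReal.ofReal M.lam * ∫⁻ z, f z ∂(M.lossMeasure 0)) ^ 2 := by
  have := hM.isProbabilityMeasure_claimLaw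
  have hZ := hM.measurable_comp_claim hf
  have hsq : ∀ a : ℕ → ENNReal, (∑' i, a i) ^ 2
      = (∑' i, a i ^ 2) + ∑' p : ℕ × ℕ, if p.1 ≠ p.2 then a p.1 * a p.2 else 0 := by
    intro a
    have hdiag : ∑' i, a i ^ 2 = ∑' p : ℕ × ℕ, if p.1 = p.2 then a p.1 * a p.2 else 0 := by
      rw [ENNReal.tsum_prod']
      refine tsum_congr fun i => ?_
      rw [tsum_eq_single i fun j hj => if_neg hj.symm, if_pos rfl, sq]
    rw [hdiag, ← ENNReal.tsum_add, sq, ← ENNReal.tsum_mul_right, ENNReal.tsum_prod']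
    refine tsum_congr fun i => ?_
    rw [← ENNReal.tsum_mul_left]
    refine tsum_congr fun j => ?_
    by_cases hij : i = j <;> simp [hij]
  simp only [hsq]
  rw [lintegral_add_left (Measurable.tsum fun i => (hZ i).pow_const 2),
    hM.lintegral_tsum_claim (f := fun z => f z ^ 2) (hf.pow_const 2)
      (fun s y hs => by simp [hf0 s y hs]),
    lintegral_tsum fun p => by
      split_ifs
      · exact ((hZ _).mul (hZ _)).aemeasurable
      · exact aemeasurable_const]
  congr 1
  rw [lossMeasure, lintegral_prod _ hf.aemeasurable,
    ← hM.poisson.tsum_lintegral_claimTime_mul hM.lam_pos.le hM.T_pos.le hf.lintegral_prod_right']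
  simp only [indicator_Iic_lintegral hf0]
  refine tsum_congr fun p => ?_
  split_ifs with hp
  · exact hM.lintegral_claim_mul hf hp
  · exact lintegral_zero

end Standing

/-- The nonnegative function `h`, extended by zero to claims that do not arrive in `(t, T]`. -/
noncomputable def claimWeight (M : Market Ω) (h : ℝ → ℝ → ℝ) (t : ℝ) : ℝ × ℝ → ENNReal :=
  (Ioc t M.T ×ˢ univ).indicator fun z => ENNReal.ofReal (Function.uncurry h z)

namespace Standing

variable {h : ℝ → ℝ → ℝ} {t : ℝ}

theorem isFiniteMeasure_lossMeasure (hM : M.Standing) (t : ℝ) :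
    IsFiniteMeasure (M.lossMeasure t) := by
  have := hM.isProbabilityMeasure_claimLaw
  unfold lossMeasure
  infer_instance

theorem lossMeasure_eq_restrict (hM : M.Standing) (ht : 0 ≤ t) :
    M.lossMeasure t = (M.lossMeasure 0).restrict (Ioc t M.T ×ˢ univ) := by
  have := hM.isProbabilityMeasure_claimLaw
  rw [lossMeasure, lossMeasure, ← Measure.prod_restrict, Measure.restrict_univ,
    Measure.restrict_restrict measurableSet_Ioc,
    inter_eq_left.2 (Ioc_subset_Ioc_left ht)]

theorem measurable_claimWeight (hh : Measurable (Function.uncurry h)) :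
    Measurable (M.claimWeight h t) :=
  hh.ennreal_ofReal.indicator (measurableSet_Ioc.prod MeasurableSet.univ)

theorem claimWeight_of_gt (s y : ℝ) (hs : M.T < s) : M.claimWeight h t (s, y) = 0 :=
  indicator_of_notMem (fun hz => absurd hz.1.2 (not_le.2 hs)) _

theorem tsum_claimWeight (hM : M.Standing) (h0 : ∀ s y, 0 ≤ h s y) (ht : t ∈ Icc 0 M.T) :
    ∀ᵐ ω ∂M.P, ∑' i, M.claimWeight h t (claimTime hM.T_pos.le M.N i ω, M.Y i ω)
      = ENNReal.ofReal (M.claimSum h t M.T ω) := by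
  filter_upwards [hM.poisson.claimTime_le_iff hM.T_pos.le,
    hM.poisson.arrivalTime_eq_claimTime hM.T_pos.le] with ω hle harr
  have hTT : M.T ∈ Icc 0 M.T := ⟨hM.T_pos.le, le_rfl⟩
  have hmem : ∀ i, claimTime hM.T_pos.le M.N i ω ∈ Ioc t M.T
      ↔ i ∈ Finset.Ico (M.N t ω) (M.N M.T ω) := by
    intro i
    rw [mem_Ioc, Finset.mem_Ico, hle i _ hTT, ← not_le, hle i _ ht, not_lt]
  rw [claimSum, ENNReal.ofReal_sum_of_nonneg fun i _ => h0 _ _,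
    tsum_eq_sum (s := Finset.Ico (M.N t ω) (M.N M.T ω))]
  · refine Finset.sum_congr rfl fun i hi => ?_
    rw [claimWeight, indicator_of_mem (mk_mem_prod ((hmem i).2 hi) (mem_univ _)),
      harr i (Finset.mem_Ico.1 hi).2]
    rfl
  · intro i hi
    exact indicator_of_notMem (fun hz => hi ((hmem i).1 hz.1)) _

theorem lintegral_claimWeight_pow (hM : M.Standing) (ht : 0 ≤ t) {k : ℕ} (hk : k ≠ 0) :
    ∫⁻ z, M.claimWeight h t z ^ k ∂(M.lossMeasure 0)
      = ∫⁻ z, ENNReal.ofReal (Function.uncurry h z) ^ k ∂(M.lossMeasure t) := by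
  rw [hM.lossMeasure_eq_restrict ht,
    ← lintegral_indicator (measurableSet_Ioc.prod MeasurableSet.univ)]
  refine lintegral_congr fun z => ?_
  by_cases hz : z ∈ Ioc t M.T ×ˢ univ
  · simp only [claimWeight, indicator_of_mem hz]
  · simp only [claimWeight, indicator_of_notMem hz, zero_pow hk]

theorem lintegral_claimSum (hM : M.Standing) (hh : Measurable (Function.uncurry h))
    (h0 : ∀ s y, 0 ≤ h s y) (ht : t ∈ Icc 0 M.T) :
    ∫⁻ ω, ENNReal.ofReal (M.claimSum h t M.T ω) ∂M.P
      = ENNReal.ofReal M.lam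
        * ∫⁻ z, ENNReal.ofReal (Function.uncurry h z) ∂(M.lossMeasure t) := by
  have := hM.lintegral_claimWeight_pow (h := h) ht.1 one_ne_zero
  simp only [pow_one] at this
  rw [← lintegral_congr_ae (hM.tsum_claimWeight h0 ht),
    hM.lintegral_tsum_claim (measurable_claimWeight hh) claimWeight_of_gt, this]

theorem lintegral_claimSum_sq (hM : M.Standing) (hh : Measurable (Function.uncurry h))
    (h0 : ∀ s y, 0 ≤ h s y) (ht : t ∈ Icc 0 M.T) :
    ∫⁻ ω, ENNReal.ofReal (M.claimSum h t M.T ω) ^ 2 ∂M.P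
      = ENNReal.ofReal M.lam
          * ∫⁻ z, ENNReal.ofReal (Function.uncurry h z) ^ 2 ∂(M.lossMeasure t)
        + (ENNReal.ofReal M.lam
          * ∫⁻ z, ENNReal.ofReal (Function.uncurry h z) ∂(M.lossMeasure t)) ^ 2 := by
  have h1 := hM.lintegral_claimWeight_pow (h := h) ht.1 one_ne_zero
  simp only [pow_one] at h1
  rw [← hM.lintegral_claimWeight_pow ht.1 two_ne_zero, ← h1,
    ← hM.lintegral_tsum_claim_sq (measurable_claimWeight hh) claimWeight_of_gt]
  refine lintegral_congr_ae ?_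
  filter_upwards [hM.tsum_claimWeight h0 ht] with ω hω
  rw [hω]

theorem claimSum_nonneg (h0 : ∀ s y, 0 ≤ h s y) (u : ℝ) (ω : Ω) : 0 ≤ M.claimSum h t u ω :=
  Finset.sum_nonneg fun _ _ => h0 _ _

theorem aestronglyMeasurable_claimSum (hM : M.Standing) (hh : Measurable (Function.uncurry h))
    (h0 : ∀ s y, 0 ≤ h s y) (ht : t ∈ Icc 0 M.T) :
    AEStronglyMeasurable (M.claimSum h t M.T) M.P := by
  have hm : Measurable fun ω =>
      (∑' i, M.claimWeight h t (claimTime hM.T_pos.le M.N i ω, M.Y i ω)).toReal :=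
    (Measurable.tsum fun i =>
      hM.measurable_comp_claim (measurable_claimWeight hh) i).ennreal_toReal
  refine ⟨_, hm.stronglyMeasurable, ?_⟩
  filter_upwards [hM.tsum_claimWeight h0 ht] with ω hω
  rw [hω, ENNReal.toReal_ofReal (claimSum_nonneg h0 _ _)]

/-- First and second moment of the claim sum of a nonnegative function. -/
theorem claimSum_moments_of_nonneg (hM : M.Standing) (hh : Measurable (Function.uncurry h))
    (h0 : ∀ s y, 0 ≤ h s y) (ht : t ∈ Icc 0 M.T)
    (hL : MemLp (Function.uncurry h) 2 (M.lossMeasure t)) :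
    MemLp (M.claimSum h t M.T) 2 M.P ∧
    ∫ ω, M.claimSum h t M.T ω ∂M.P = M.lam * ∫ z, Function.uncurry h z ∂(M.lossMeasure t) ∧
    ∫ ω, M.claimSum h t M.T ω ^ 2 ∂M.P
      = M.lam * ∫ z, Function.uncurry h z ^ 2 ∂(M.lossMeasure t)
        + (M.lam * ∫ z, Function.uncurry h z ∂(M.lossMeasure t)) ^ 2 := by
  have := hM.isFiniteMeasure_lossMeasure t
  have hpos := hM.lam_pos
  have hm := hM.aestronglyMeasurable_claimSum hh h0 ht
  have hS0 : ∀ ω, 0 ≤ M.claimSum h t M.T ω := claimSum_nonneg h0 _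
  have hz0 : ∀ z, 0 ≤ Function.uncurry h z := fun z => h0 _ _
  have hi1 : Integrable (Function.uncurry h) (M.lossMeasure t) := hL.integrable (by norm_num)
  have hi2 := hL.integrable_sq
  have hfin1 := hi1.lintegral_lt_top
  have hfin2 := hi2.lintegral_lt_top
  have e1 : ∫ z, Function.uncurry h z ∂(M.lossMeasure t)
      = (∫⁻ z, ENNReal.ofReal (Function.uncurry h z) ∂(M.lossMeasure t)).toReal :=
    integral_eq_lintegral_of_nonneg_ae (ae_of_all _ hz0) hi1.1
  have e2 : ∫ z, Function.uncurry h z ^ 2 ∂(M.lossMeasure t)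
      = (∫⁻ z, ENNReal.ofReal (Function.uncurry h z ^ 2) ∂(M.lossMeasure t)).toReal :=
    integral_eq_lintegral_of_nonneg_ae (ae_of_all _ fun z => sq_nonneg _) hi2.1
  have e3 : ∫ ω, M.claimSum h t M.T ω ∂M.P
      = (∫⁻ ω, ENNReal.ofReal (M.claimSum h t M.T ω) ∂M.P).toReal :=
    integral_eq_lintegral_of_nonneg_ae (ae_of_all _ hS0) hm
  have e4 : ∫ ω, M.claimSum h t M.T ω ^ 2 ∂M.P
      = (∫⁻ ω, ENNReal.ofReal (M.claimSum h t M.T ω ^ 2) ∂M.P).toReal :=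
    integral_eq_lintegral_of_nonneg_ae (ae_of_all _ fun z => sq_nonneg _) (hm.pow 2)
  have l1 := hM.lintegral_claimSum hh h0 ht
  have l2 := hM.lintegral_claimSum_sq hh h0 ht
  simp only [← ENNReal.ofReal_pow (hS0 _), ← ENNReal.ofReal_pow (hz0 _)] at l2
  have hlt : ENNReal.ofReal M.lam
        * ∫⁻ z, ENNReal.ofReal (Function.uncurry h z) ∂(M.lossMeasure t) < ⊤ :=
    ENNReal.mul_lt_top ENNReal.ofReal_lt_top hfin1
  have hlt2 : ENNReal.ofReal M.lam
        * ∫⁻ z, ENNReal.ofReal (Function.uncurry h z ^ 2) ∂(M.lossMeasure t) < ⊤ :=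
    ENNReal.mul_lt_top ENNReal.ofReal_lt_top hfin2
  refine ⟨?_, ?_, ?_⟩
  · rw [memLp_two_iff_integrable_sq hm]
    refine ⟨hm.pow 2, ?_⟩
    rw [hasFiniteIntegral_iff_ofReal (ae_of_all _ fun z => sq_nonneg _), l2]
    exact ENNReal.add_lt_top.2 ⟨hlt2, ENNReal.pow_lt_top hlt⟩
  · rw [e3, l1, e1, ENNReal.toReal_mul, ENNReal.toReal_ofReal hpos.le]
  · rw [e4, l2, ENNReal.toReal_add hlt2.ne (ENNReal.pow_lt_top hlt).ne, ENNReal.toReal_pow,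
      ENNReal.toReal_mul, ENNReal.toReal_mul, ENNReal.toReal_ofReal hpos.le, ← e1, ← e2]

/-- Square integrability, mean and variance of the claim sum of a square integrable function. -/
theorem claimSum_moments (hM : M.Standing) (hh : Measurable (Function.uncurry h))
    (ht : t ∈ Icc 0 M.T) (hL : MemLp (Function.uncurry h) 2 (M.lossMeasure t)) :
    MemLp (M.claimSum h t M.T) 2 M.P ∧
    ∫ ω, M.claimSum h t M.T ω ∂M.P = M.lam * ∫ z, Function.uncurry h z ∂(M.lossMeasure t) ∧
    variance (M.claimSum h t M.T) M.P
      = M.lam * ∫ z, Function.uncurry h z ^ 2 ∂(M.lossMeasure t) := by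
  have := hM.prob
  have := hM.isFiniteMeasure_lossMeasure t
  have hmp : Measurable (Function.uncurry fun s y => max (h s y) 0) := hh.max measurable_const
  have hmn : Measurable (Function.uncurry fun s y => max (-h s y) 0) := hh.neg.max measurable_const
  have hma : Measurable (Function.uncurry fun s y => |h s y|) := hh.abs
  have hLp : MemLp (Function.uncurry fun s y => max (h s y) 0) 2 (M.lossMeasure t) :=
    hL.mono hmp.aestronglyMeasurable (ae_of_all _ fun z => by
      simp only [Function.uncurry, Real.norm_eq_abs]
      rw [abs_of_nonneg (le_max_right _ _)]
      exact max_le (le_abs_self _) (abs_nonneg _))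
  have hLn : MemLp (Function.uncurry fun s y => max (-h s y) 0) 2 (M.lossMeasure t) :=
    hL.mono hmn.aestronglyMeasurable (ae_of_all _ fun z => by
      simp only [Function.uncurry, Real.norm_eq_abs]
      rw [abs_of_nonneg (le_max_right _ _)]
      exact max_le (neg_le_abs _) (abs_nonneg _))
  have hLa : MemLp (Function.uncurry fun s y => |h s y|) 2 (M.lossMeasure t) := hL.abs
  obtain ⟨p1, p2, p3⟩ := hM.claimSum_moments_of_nonneg hmp (fun _ _ => le_max_right _ _) ht hLp
  obtain ⟨n1, n2, n3⟩ := hM.claimSum_moments_of_nonneg hmn (fun _ _ => le_max_right _ _) ht hLn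
  obtain ⟨a1, a2, a3⟩ := hM.claimSum_moments_of_nonneg hma (fun _ _ => abs_nonneg _) ht hLa
  have hsub : M.claimSum h t M.T = M.claimSum (fun s y => max (h s y) 0) t M.T
      - M.claimSum (fun s y => max (-h s y) 0) t M.T := by
    ext ω
    simp only [claimSum, Pi.sub_apply]
    rw [← Finset.sum_sub_distrib]
    exact Finset.sum_congr rfl fun i _ => (max_zero_sub_max_neg_zero_eq_self _).symm
  have hadd : M.claimSum (fun s y => |h s y|) t M.T = M.claimSum (fun s y => max (h s y) 0) t M.T
      + M.claimSum (fun s y => max (-h s y) 0) t M.T := by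
    ext ω
    simp only [claimSum, Pi.add_apply]
    rw [← Finset.sum_add_distrib]
    exact Finset.sum_congr rfl fun i _ => (max_zero_add_max_neg_zero_eq_abs_self _).symm
  have i1 : ∫ z, Function.uncurry h z ∂(M.lossMeasure t)
      = ∫ z, Function.uncurry (fun s y => max (h s y) 0) z ∂(M.lossMeasure t)
        - ∫ z, Function.uncurry (fun s y => max (-h s y) 0) z ∂(M.lossMeasure t) := by
    rw [← integral_sub (hLp.integrable (by norm_num)) (hLn.integrable (by norm_num))]
    refine integral_congr_ae (ae_of_all _ fun z => ?_)
    exact (max_zero_sub_max_neg_zero_eq_self _).symm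
  have i2 : ∫ z, Function.uncurry (fun s y => |h s y|) z ∂(M.lossMeasure t)
      = ∫ z, Function.uncurry (fun s y => max (h s y) 0) z ∂(M.lossMeasure t)
        + ∫ z, Function.uncurry (fun s y => max (-h s y) 0) z ∂(M.lossMeasure t) := by
    rw [← integral_add (hLp.integrable (by norm_num)) (hLn.integrable (by norm_num))]
    refine integral_congr_ae (ae_of_all _ fun z => ?_)
    exact (max_zero_add_max_neg_zero_eq_abs_self _).symm
  have i3 : ∫ z, Function.uncurry h z ^ 2 ∂(M.lossMeasure t)
      = ∫ z, Function.uncurry (fun s y => max (h s y) 0) z ^ 2 ∂(M.lossMeasure t)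
        + ∫ z, Function.uncurry (fun s y => max (-h s y) 0) z ^ 2 ∂(M.lossMeasure t) := by
    rw [← integral_add hLp.integrable_sq hLn.integrable_sq]
    refine integral_congr_ae (ae_of_all _ fun z => ?_)
    simp only [Function.uncurry]
    rcases le_total 0 (h z.1 z.2) with hz | hz
    · rw [max_eq_left hz, max_eq_right (by linarith)]; ring
    · rw [max_eq_right hz, max_eq_left (by linarith)]; ring
  have i4 : ∫ z, Function.uncurry (fun s y => |h s y|) z ^ 2 ∂(M.lossMeasure t)
      = ∫ z, Function.uncurry h z ^ 2 ∂(M.lossMeasure t) := by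
    refine integral_congr_ae (ae_of_all _ fun z => ?_)
    simp only [Function.uncurry, sq_abs]
  have hS : MemLp (M.claimSum h t M.T) 2 M.P := hsub ▸ p1.sub n1
  have hmean : ∫ ω, M.claimSum h t M.T ω ∂M.P
      = M.lam * ∫ z, Function.uncurry h z ∂(M.lossMeasure t) := by
    rw [hsub, integral_sub' (p1.integrable (by norm_num)) (n1.integrable (by norm_num)), p2, n2, i1]
    ring
  -- The mixed term of `(S₊ - S₋)²` is eliminated by the parallelogram law with `S₊ + S₋`.
  have hsq : ∫ ω, M.claimSum h t M.T ω ^ 2 ∂M.P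
      = 2 * ∫ ω, M.claimSum (fun s y => max (h s y) 0) t M.T ω ^ 2 ∂M.P
        + 2 * ∫ ω, M.claimSum (fun s y => max (-h s y) 0) t M.T ω ^ 2 ∂M.P
        - ∫ ω, M.claimSum (fun s y => |h s y|) t M.T ω ^ 2 ∂M.P := by
    rw [← integral_const_mul, ← integral_const_mul,
      ← integral_add (p1.integrable_sq.const_mul 2) (n1.integrable_sq.const_mul 2),
      ← integral_sub (f := fun ω => 2 * M.claimSum (fun s y => max (h s y) 0) t M.T ω ^ 2
        + 2 * M.claimSum (fun s y => max (-h s y) 0) t M.T ω ^ 2)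
        ((p1.integrable_sq.const_mul 2).add (n1.integrable_sq.const_mul 2)) a1.integrable_sq]
    refine integral_congr_ae (ae_of_all _ fun ω => ?_)
    simp only [hsub, hadd, Pi.sub_apply, Pi.add_apply]
    ring
  refine ⟨hS, hmean, ?_⟩
  rw [variance_eq_sub hS, hmean]
  simp only [Pi.pow_apply]
  rw [hsq, p3, n3, a3, i4, i3, i2, i1]
  ring

end Standing

end Market

/-! ### The customer's utility as an integral -/

/-- The rate, per unit of `lam ds F(dy)`, at which the coverage `l` of a claim `y` lowers the
utility of a customer with risk aversion `γ` and loading `θ`: the premium `(1 + θ) l`, the expected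
retention `y - l`, and the variance penalty of the retention. -/
noncomputable def coverageCost (θ γ l y : ℝ) : ℝ := θ * l + y + γ / 2 * (y - l) ^ 2

/-- The excess-of-loss coverage minimizes the cost pointwise, with a quadratic gap. -/
theorem sq_le_coverageCost_sub {θ γ l : ℝ} (hγ : 0 < γ) (hl : 0 ≤ l) (y : ℝ) :
    γ / 2 * (l - max (y - θ / γ) 0) ^ 2
      ≤ coverageCost θ γ l y - coverageCost θ γ (max (y - θ / γ) 0) y := by
  have hθ : γ * (θ / γ) = θ := mul_div_cancel₀ θ hγ.ne'
  generalize θ / γ = d at hθ ⊢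
  unfold coverageCost
  rcases le_total 0 (y - d) with h | h
  · rw [max_eq_left h]
    apply le_of_eq
    linear_combination (l - y + d) * hθ
  · rw [max_eq_right h]
    have : 0 ≤ l * (γ * d - γ * y) := mul_nonneg hl (by nlinarith)
    nlinarith

namespace Market

variable {Ω : Type*} [MeasurableSpace Ω] {M : Market Ω}

namespace Standing

variable {l l' : ℝ → ℝ → ℝ} {ξ : ℝ → ℝ} {γ γ' t x θ : ℝ}

theorem prod_eq_lossMeasure (M : Market Ω) :
    (volume.restrict (Icc (0 : ℝ) M.T)).prod M.claimLaw = M.lossMeasure 0 := by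
  rw [lossMeasure, restrict_Ioc_eq_restrict_Icc]

theorem memLp_lossMeasure (hM : M.Standing) (hl : M.Admissible l) (ht : 0 ≤ t) :
    MemLp (Function.uncurry l) 2 (M.lossMeasure t) := by
  have := hl.sqIntegrable
  rw [prod_eq_lossMeasure] at this
  rw [hM.lossMeasure_eq_restrict ht]
  exact this.restrict _

theorem memLp_claimLaw (hM : M.Standing) : MemLp (fun y : ℝ => y) 2 M.claimLaw :=
  (memLp_map_measure_iff aestronglyMeasurable_id (hM.measurableY 0).aemeasurable).2
    hM.sqIntegrableY

theorem memLp_snd (hM : M.Standing) (t : ℝ) : MemLp (fun z : ℝ × ℝ => z.2) 2 (M.lossMeasure t) :=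
  have := hM.isProbabilityMeasure_claimLaw
  hM.memLp_claimLaw.comp_snd _

theorem ae_lossMeasure (hM : M.Standing) (t : ℝ) :
    ∀ᵐ z ∂(M.lossMeasure t), z.1 ∈ Ioc t M.T ∧ 0 < z.2 := by
  have := hM.isProbabilityMeasure_claimLaw
  have h1 : ∀ᵐ s ∂(volume.restrict (Ioc t M.T)), s ∈ Ioc t M.T :=
    ae_restrict_mem measurableSet_Ioc
  have h2 : ∀ᵐ y ∂M.claimLaw, 0 < y :=
    (ae_map_iff (hM.measurableY 0).aemeasurable measurableSet_Ioi).2 (hM.posY 0)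
  filter_upwards [Measure.quasiMeasurePreserving_fst.ae h1,
    Measure.quasiMeasurePreserving_snd.ae h2] with z hz1 hz2
  exact ⟨hz1, hz2⟩

theorem ae_nonneg_of_admissible (hM : M.Standing) (hl : M.Admissible l) (ht : 0 ≤ t) :
    ∀ᵐ z ∂(M.lossMeasure t), 0 ≤ Function.uncurry l z := by
  filter_upwards [hM.ae_lossMeasure t] with z hz
  exact hl.nonneg z.1 ⟨ht.trans hz.1.1.le, hz.1.2⟩ z.2 hz.2

theorem integral_snd_lossMeasure (hM : M.Standing) (ht : t ≤ M.T) {g : ℝ → ℝ} (hg : Measurable g) :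
    ∫ z, g z.2 ∂(M.lossMeasure t) = (M.T - t) * ∫ ω, g (M.Y 0 ω) ∂M.P := by
  have := hM.isProbabilityMeasure_claimLaw
  have h := integral_prod_mul (μ := volume.restrict (Ioc t M.T)) (ν := M.claimLaw)
    (fun _ => (1 : ℝ)) g
  simp only [one_mul] at h
  rw [lossMeasure, h, integral_const, claimLaw,
    integral_map (hM.measurableY 0).aemeasurable hg.aestronglyMeasurable]
  simp [measureReal_def, ht]

theorem integrable_coverageCost (hM : M.Standing) (θ γ : ℝ)
    (hl : MemLp (Function.uncurry l) 2 (M.lossMeasure t)) :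
    Integrable (fun z => coverageCost θ γ (Function.uncurry l z) z.2) (M.lossMeasure t) := by
  have := hM.isFiniteMeasure_lossMeasure t
  have h2 := hM.memLp_snd t
  exact (((hl.integrable (by norm_num)).const_mul θ).add (h2.integrable (by norm_num))).add
    ((h2.sub hl).integrable_sq.const_mul (γ / 2))

theorem measurable_retention (hl : M.Admissible l) :
    Measurable (Function.uncurry fun s y => y - l s y) :=
  measurable_snd.sub hl.measurable

theorem memLp_retention (hM : M.Standing) (hl : M.Admissible l) (ht : 0 ≤ t) :
    MemLp (Function.uncurry fun s y => y - l s y) 2 (M.lossMeasure t) :=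
  (hM.memLp_snd t).sub (hM.memLp_lossMeasure hl ht)

theorem integral_premiumRate (hM : M.Standing) (hl : M.Admissible l) (ht : t ∈ Icc 0 M.T) :
    ∫ s in t..M.T, M.premiumRate ξ γ' l s
      = (1 + ξ γ') * M.lam * ∫ z, Function.uncurry l z ∂(M.lossMeasure t) := by
  have := hM.isFiniteMeasure_lossMeasure t
  have := hM.isProbabilityMeasure_claimLaw
  have hi := (hM.memLp_lossMeasure hl ht.1).integrable (by norm_num)
  unfold premiumRate
  rw [intervalIntegral.integral_of_le ht.2, integral_const_mul, lossMeasure,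
    integral_prod _ hi]
  rfl

theorem memLp_customerSurplus (hM : M.Standing) (hl : M.Admissible l) (ht : t ∈ Icc 0 M.T) :
    MemLp (M.customerSurplus ξ γ' l t x M.T) 2 M.P := by
  have := hM.prob
  exact (memLp_const _).sub
    (hM.claimSum_moments (measurable_retention hl) ht (hM.memLp_retention hl ht.1)).1

/-- The customer's utility as an integral over time and claim size. -/
theorem customerUtility_eq (hM : M.Standing) (hl : M.Admissible l) (ht : t ∈ Icc 0 M.T) :
    M.customerUtility ξ γ γ' t x l
      = x - M.lam * ∫ z, coverageCost (ξ γ') γ (Function.uncurry l z) z.2 ∂(M.lossMeasure t) := by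
  have := hM.prob
  have := hM.isFiniteMeasure_lossMeasure t
  have hL := hM.memLp_lossMeasure hl ht.1
  have h2 := hM.memLp_snd t
  have hi := hL.integrable (q := 2) (by norm_num)
  have hi2 := h2.integrable (q := 2) (by norm_num)
  have hr := hM.memLp_retention hl ht.1
  obtain ⟨hS, hmean, hvar⟩ := hM.claimSum_moments (measurable_retention hl) ht hr
  have hcost : ∫ z, coverageCost (ξ γ') γ (Function.uncurry l z) z.2 ∂(M.lossMeasure t)
      = ξ γ' * (∫ z, Function.uncurry l z ∂(M.lossMeasure t)) + (∫ z, z.2 ∂(M.lossMeasure t))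
        + γ / 2 * ∫ z, (Function.uncurry (fun s y => y - l s y) z) ^ 2 ∂(M.lossMeasure t) := by
    rw [← integral_const_mul, ← integral_const_mul, ← integral_add (hi.const_mul _) hi2,
      ← integral_add (f := fun z => ξ γ' * Function.uncurry l z + z.2)
        ((hi.const_mul _).add hi2) (hr.integrable_sq.const_mul _)]
    rfl
  have hret : ∫ z, Function.uncurry (fun s y => y - l s y) z ∂(M.lossMeasure t)
      = (∫ z, z.2 ∂(M.lossMeasure t)) - ∫ z, Function.uncurry l z ∂(M.lossMeasure t) := by
    rw [← integral_sub hi2 hi]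
    rfl
  have hsurplus : M.customerSurplus ξ γ' l t x M.T
      = fun ω => (x - ∫ s in t..M.T, M.premiumRate ξ γ' l s)
        - M.claimSum (fun s y => y - l s y) t M.T ω := rfl
  rw [customerUtility, meanVariance, hsurplus, variance_const_sub hS.1, hvar,
    integral_sub (integrable_const _) (hS.integrable (by norm_num)), hmean, hret,
    hM.integral_premiumRate hl ht, hcost]
  simp only [integral_const, probReal_univ, smul_eq_mul]
  ring

/-- The insurer's utility from an arbitrary coverage, by Campbell's formulas. -/
theorem insurer_moments (hM : M.Standing) (hl : M.Admissible l) :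
    MemLp (M.insurerWealth ξ γ' l M.T) 2 M.P ∧
    meanVariance M.P M.γI (M.insurerWealth ξ γ' l M.T)
      = M.lam * (ξ γ' * (∫ z, Function.uncurry l z ∂(M.lossMeasure 0))
        - M.γI / 2 * ∫ z, Function.uncurry l z ^ 2 ∂(M.lossMeasure 0)) := by
  have := hM.prob
  have ht : (0 : ℝ) ∈ Icc 0 M.T := ⟨le_rfl, hM.T_pos.le⟩
  have hL := hM.memLp_lossMeasure hl le_rfl
  obtain ⟨hS, hmean, hvar⟩ := hM.claimSum_moments hl.measurable ht hL
  have hwealth : M.insurerWealth ξ γ' l M.T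
      = fun ω => (∫ s in (0 : ℝ)..M.T, M.premiumRate ξ γ' l s) - M.claimSum l 0 M.T ω := rfl
  refine ⟨(memLp_const _).sub hS, ?_⟩
  rw [meanVariance, hwealth, variance_const_sub hS.1, hvar,
    integral_sub (integrable_const _) (hS.integrable (by norm_num)), hmean,
    hM.integral_premiumRate hl ht]
  simp only [integral_const, probReal_univ, smul_eq_mul]
  ring

/-! ### Optimal coverages -/

theorem admissible_excessOfLoss (hM : M.Standing) (hd : 0 ≤ θ / γ) :
    M.Admissible (excessOfLoss θ γ) := by
  have hm : Measurable (Function.uncurry (excessOfLoss θ γ)) :=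
    (measurable_snd.sub_const _).max measurable_const
  refine ⟨hm, fun s _ y _ => le_max_right _ _, ?_⟩
  rw [prod_eq_lossMeasure]
  refine (hM.memLp_snd 0).mono hm.aestronglyMeasurable ?_
  filter_upwards [hM.ae_lossMeasure 0] with z hz
  rw [Real.norm_eq_abs, Real.norm_eq_abs, abs_of_pos hz.2]
  change |max (z.2 - θ / γ) 0| ≤ z.2
  rw [abs_of_nonneg (le_max_right _ _)]
  exact max_le (by linarith) hz.2.le

/-- The utility lost by a coverage `l` in comparison with the excess-of-loss coverage. -/
theorem customerUtility_excessOfLoss_sub (hM : M.Standing) (hd : 0 ≤ ξ γ' / γ)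
    (hl : M.Admissible l) (ht : t ∈ Icc 0 M.T) :
    M.customerUtility ξ γ γ' t x (excessOfLoss (ξ γ') γ) - M.customerUtility ξ γ γ' t x l
      = M.lam * ∫ z, (coverageCost (ξ γ') γ (Function.uncurry l z) z.2
        - coverageCost (ξ γ') γ (max (z.2 - ξ γ' / γ) 0) z.2) ∂(M.lossMeasure t) := by
  have he := hM.admissible_excessOfLoss hd
  have hsub := integral_sub
    (hM.integrable_coverageCost (ξ γ') γ (hM.memLp_lossMeasure hl ht.1))
    (hM.integrable_coverageCost (ξ γ') γ (hM.memLp_lossMeasure he ht.1))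
  rw [hM.customerUtility_eq hl ht, hM.customerUtility_eq he ht, sub_sub_sub_cancel_left,
    ← mul_sub, ← hsub]
  rfl

theorem ae_coverageCost_gap (hM : M.Standing) (hγ : 0 < γ) (hl : M.Admissible l) (ht : 0 ≤ t) :
    ∀ᵐ z ∂(M.lossMeasure t), γ / 2 * (Function.uncurry l z - max (z.2 - θ / γ) 0) ^ 2
      ≤ coverageCost θ γ (Function.uncurry l z) z.2
        - coverageCost θ γ (max (z.2 - θ / γ) 0) z.2 := by
  filter_upwards [hM.ae_nonneg_of_admissible hl ht] with z hz
  exact sq_le_coverageCost_sub hγ hz z.2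

theorem customerUtility_le (hM : M.Standing) (hγ : 0 < γ) (hξ : 0 ≤ ξ γ')
    (hl : M.Admissible l) (ht : t ∈ Icc 0 M.T) :
    M.customerUtility ξ γ γ' t x l ≤ M.customerUtility ξ γ γ' t x (excessOfLoss (ξ γ') γ) := by
  rw [← sub_nonneg, hM.customerUtility_excessOfLoss_sub (div_nonneg hξ hγ.le) hl ht]
  refine mul_nonneg hM.lam_pos.le (integral_nonneg_of_ae ?_)
  filter_upwards [hM.ae_coverageCost_gap hγ hl ht.1] with z hz
  exact (by positivity : (0 : ℝ) ≤ _).trans hz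

theorem ae_eq_of_customerUtility_le (hM : M.Standing) (hγ : 0 < γ) (hξ : 0 ≤ ξ γ')
    (hl : M.Admissible l) (ht : t ∈ Icc 0 M.T)
    (hle : M.customerUtility ξ γ γ' t x (excessOfLoss (ξ γ') γ)
      ≤ M.customerUtility ξ γ γ' t x l) :
    ∀ᵐ z ∂(M.lossMeasure t), Function.uncurry l z = max (z.2 - ξ γ' / γ) 0 := by
  have hd : 0 ≤ ξ γ' / γ := div_nonneg hξ hγ.le
  have he := hM.admissible_excessOfLoss hd
  have hgap := hM.ae_coverageCost_gap (θ := ξ γ') hγ hl ht.1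
  have hnn : ∀ᵐ z ∂(M.lossMeasure t), 0 ≤ coverageCost (ξ γ') γ (Function.uncurry l z) z.2
        - coverageCost (ξ γ') γ (max (z.2 - ξ γ' / γ) 0) z.2 := by
    filter_upwards [hgap] with z hz
    exact (by positivity : (0 : ℝ) ≤ _).trans hz
  have hint : Integrable (fun z => coverageCost (ξ γ') γ (Function.uncurry l z) z.2
        - coverageCost (ξ γ') γ (max (z.2 - ξ γ' / γ) 0) z.2) (M.lossMeasure t) :=
    (hM.integrable_coverageCost _ _ (hM.memLp_lossMeasure hl ht.1)).sub
      (hM.integrable_coverageCost _ _ (hM.memLp_lossMeasure he ht.1))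
  have heq := hM.customerUtility_excessOfLoss_sub (x := x) hd hl ht
  have h0 : ∫ z, (coverageCost (ξ γ') γ (Function.uncurry l z) z.2
        - coverageCost (ξ γ') γ (max (z.2 - ξ γ' / γ) 0) z.2) ∂(M.lossMeasure t) = 0 := by
    refine le_antisymm ?_ (integral_nonneg_of_ae hnn)
    have := hM.lam_pos
    by_contra hpos
    rw [not_le] at hpos
    nlinarith [mul_pos this hpos]
  filter_upwards [(integral_eq_zero_iff_of_nonneg_ae hnn hint).1 h0, hgap] with z hz hz'
  rw [hz] at hz'
  have : (Function.uncurry l z - max (z.2 - ξ γ' / γ) 0) ^ 2 ≤ 0 := by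
    simp only [Pi.zero_apply] at hz'
    by_contra hpos
    rw [not_le] at hpos
    nlinarith [mul_pos hγ hpos]
  exact sub_eq_zero.1 (pow_eq_zero_iff two_ne_zero |>.1 (le_antisymm this (sq_nonneg _)))

theorem customerUtility_congr (hM : M.Standing) (hl : M.Admissible l) (hl' : M.Admissible l')
    (ht : t ∈ Icc 0 M.T)
    (h : ∀ᵐ z ∂(M.lossMeasure t), Function.uncurry l z = Function.uncurry l' z) :
    M.customerUtility ξ γ γ' t x l = M.customerUtility ξ γ γ' t x l' := by
  rw [hM.customerUtility_eq hl ht, hM.customerUtility_eq hl' ht]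
  congr 2
  refine integral_congr_ae ?_
  filter_upwards [h] with z hz
  rw [hz]

/-- The excess-of-loss coverage is optimal, and every optimal coverage agrees with it almost
everywhere. -/
theorem isOptimalCoverage_iff (hM : M.Standing) (hγ : 0 < γ) (hξ : 0 ≤ ξ γ') :
    M.IsOptimalCoverage ξ γ γ' l ↔ M.Admissible l ∧
      ∀ᵐ z ∂(M.lossMeasure 0), Function.uncurry l z = max (z.2 - ξ γ' / γ) 0 := by
  have ht : (0 : ℝ) ∈ Icc 0 M.T := ⟨le_rfl, hM.T_pos.le⟩
  have he := hM.admissible_excessOfLoss (div_nonneg hξ hγ.le)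
  refine and_congr_right fun hl => ⟨fun h => ?_, fun h l' hl' => ?_⟩
  · exact hM.ae_eq_of_customerUtility_le hγ hξ hl ht (h he)
  · change M.customerUtility ξ γ γ' 0 M.xC l' ≤ M.customerUtility ξ γ γ' 0 M.xC l
    rw [hM.customerUtility_congr hl he ht h]
    exact hM.customerUtility_le hγ hξ hl' ht

theorem isOptimalCoverage_excessOfLoss (hM : M.Standing) (hγ : 0 < γ) (hξ : 0 ≤ ξ γ') :
    M.IsOptimalCoverage ξ γ γ' (excessOfLoss (ξ γ') γ) :=
  (hM.isOptimalCoverage_iff hγ hξ).2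
    ⟨hM.admissible_excessOfLoss (div_nonneg hξ hγ.le), ae_of_all _ fun _ => rfl⟩

theorem customerValue_eq (hM : M.Standing) (hγ : 0 < γ) (hξ : 0 ≤ ξ γ') :
    M.customerValue ξ γ γ' = M.customerUtility ξ γ γ' 0 M.xC (excessOfLoss (ξ γ') γ) := by
  have ht : (0 : ℝ) ∈ Icc 0 M.T := ⟨le_rfl, hM.T_pos.le⟩
  have hle : ∀ l : {l : ℝ → ℝ → ℝ // M.Admissible l}, M.customerUtility ξ γ γ' 0 M.xC l
      ≤ M.customerUtility ξ γ γ' 0 M.xC (excessOfLoss (ξ γ') γ) := fun l =>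
    hM.customerUtility_le hγ hξ l.2 ht
  have he := hM.admissible_excessOfLoss (div_nonneg hξ hγ.le)
  have : Nonempty {l : ℝ → ℝ → ℝ // M.Admissible l} := ⟨⟨_, he⟩⟩
  refine le_antisymm (ciSup_le hle) ?_
  exact le_ciSup (f := fun l : {l : ℝ → ℝ → ℝ // M.Admissible l} =>
    M.customerUtility ξ γ γ' 0 M.xC l) ⟨_, by rintro _ ⟨l, rfl⟩; exact hle l⟩ ⟨_, he⟩

end Standing

end Market

/-! ### Equilibrium strategies -/

namespace Market

variable {Ω : Type*} [MeasurableSpace Ω] {M : Market Ω}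

/-- The utility rate lost at time `s` by the coverage `l` in comparison with the excess-of-loss
coverage. -/
noncomputable def costGap (M : Market Ω) (θ γ : ℝ) (l : ℝ → ℝ → ℝ) (s : ℝ) : ℝ :=
  ∫ y, (coverageCost θ γ (l s y) y - coverageCost θ γ (max (y - θ / γ) 0) y) ∂M.claimLaw

namespace Standing

variable {l : ℝ → ℝ → ℝ} {ξ : ℝ → ℝ} {γ γ' t x θ ε : ℝ}

theorem perturbed_of_mem {l : ℝ → ℝ → ℝ} {lbar : ℝ → ℝ} {s : ℝ} (hs : s ∈ Ico t (t + ε)) (y : ℝ) :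
    perturbed l lbar t ε s y = lbar y := if_pos hs

theorem perturbed_of_notMem {l : ℝ → ℝ → ℝ} {lbar : ℝ → ℝ} {s : ℝ} (hs : s ∉ Ico t (t + ε))
    (y : ℝ) : perturbed l lbar t ε s y = l s y := if_neg hs

theorem admissible_perturbed (hM : M.Standing) (hl : M.Admissible l) (hd : 0 ≤ θ / γ) (t ε : ℝ) :
    M.Admissible (perturbed l (fun y => max (y - θ / γ) 0) t ε) := by
  classical
  have he := hM.admissible_excessOfLoss hd
  have hm : Measurable (Function.uncurry (perturbed l (fun y => max (y - θ / γ) 0) t ε)) :=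
    Measurable.ite (measurable_fst measurableSet_Ico) he.measurable hl.measurable
  refine ⟨hm, fun s hs y hy => ?_, ?_⟩
  · by_cases h : s ∈ Ico t (t + ε)
    · rw [perturbed_of_mem h]
      exact le_max_right _ _
    · rw [perturbed_of_notMem h]
      exact hl.nonneg s hs y hy
  · refine (hl.sqIntegrable.norm.add he.sqIntegrable.norm).mono hm.aestronglyMeasurable
      (ae_of_all _ fun z => ?_)
    simp only [Pi.add_apply]
    rw [Real.norm_of_nonneg (r := ‖Function.uncurry l z‖ + _) (by positivity)]
    by_cases h : z.1 ∈ Ico t (t + ε)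
    · rw [Function.uncurry, perturbed_of_mem h]
      exact le_add_of_nonneg_left (norm_nonneg _)
    · rw [Function.uncurry, perturbed_of_notMem h]
      exact le_add_of_nonneg_right (norm_nonneg _)

theorem integrable_coverageCost_sub (hM : M.Standing) (hl : M.Admissible l) (hd : 0 ≤ θ / γ)
    (ht : 0 ≤ t) :
    Integrable (fun z => coverageCost θ γ (Function.uncurry l z) z.2
      - coverageCost θ γ (max (z.2 - θ / γ) 0) z.2) (M.lossMeasure t) :=
  (hM.integrable_coverageCost _ _ (hM.memLp_lossMeasure hl ht)).sub
    (hM.integrable_coverageCost _ _ (hM.memLp_lossMeasure (hM.admissible_excessOfLoss hd) ht))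

theorem integrableOn_costGap (hM : M.Standing) (hl : M.Admissible l) (hd : 0 ≤ θ / γ) :
    IntegrableOn (M.costGap θ γ l) (Ioc 0 M.T) :=
  have := hM.isProbabilityMeasure_claimLaw
  (hM.integrable_coverageCost_sub hl hd le_rfl).integral_prod_left

/-- The utility gained by the excess-of-loss perturbation of `l` on `[t, t + ε)`. -/
theorem customerUtility_sub_perturbed (hM : M.Standing) (hl : M.Admissible l)
    (hd : 0 ≤ ξ γ' / γ) (ht : 0 ≤ t) (hε : 0 ≤ ε) (htε : t + ε ≤ M.T) :
    M.customerUtility ξ γ γ' t x l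
        - M.customerUtility ξ γ γ' t x (perturbed l (fun y => max (y - ξ γ' / γ) 0) t ε)
      = -(M.lam * ∫ s in t..(t + ε), (Ioc 0 M.T).indicator (M.costGap (ξ γ') γ l) s) := by
  have := hM.isProbabilityMeasure_claimLaw
  have htT : t ∈ Icc 0 M.T := ⟨ht, by linarith⟩
  have hp := hM.admissible_perturbed hl hd t ε
  have h1 := hM.integrable_coverageCost (ξ γ') γ (hM.memLp_lossMeasure hl ht)
  have h2 := hM.integrable_coverageCost (ξ γ') γ (hM.memLp_lossMeasure hp ht)
  have hinner : ∀ s ∈ Ioc t M.T, (∫ y, (coverageCost (ξ γ') γ (l s y) y - coverageCost (ξ γ') γ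
      (perturbed l (fun y => max (y - ξ γ' / γ) 0) t ε s y) y) ∂M.claimLaw)
      = (Iio (t + ε)).indicator (M.costGap (ξ γ') γ l) s := by
    intro s hs
    by_cases hsε : s < t + ε
    · rw [indicator_of_mem (mem_Iio.2 hsε)]
      simp only [perturbed_of_mem (show s ∈ Ico t (t + ε) from ⟨hs.1.le, hsε⟩)]
      rfl
    · rw [indicator_of_notMem (by simpa using hsε)]
      simp only [perturbed_of_notMem (fun h : s ∈ Ico t (t + ε) => hsε h.2), sub_self,
        integral_zero]
  have hset : Ioc t M.T ∩ Iio (t + ε) = Ioo t (t + ε) := by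
    ext s
    simp only [mem_inter_iff, mem_Ioc, mem_Iio, mem_Ioo]
    constructor
    · rintro ⟨⟨h1, -⟩, h2⟩
      exact ⟨h1, h2⟩
    · rintro ⟨h1, h2⟩
      exact ⟨⟨h1, h2.le.trans htε⟩, h2⟩
  have hmain : ∫ z, (coverageCost (ξ γ') γ (Function.uncurry l z) z.2 - coverageCost (ξ γ') γ
      (Function.uncurry (perturbed l (fun y => max (y - ξ γ' / γ) 0) t ε) z) z.2)
        ∂(M.lossMeasure t)
      = ∫ s in t..(t + ε), (Ioc 0 M.T).indicator (M.costGap (ξ γ') γ l) s := by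
    have hi := h1.sub h2
    rw [lossMeasure] at hi ⊢
    refine (integral_prod _ hi).trans ?_
    refine (setIntegral_congr_fun measurableSet_Ioc hinner).trans ?_
    rw [setIntegral_indicator measurableSet_Iio, hset, ← integral_Ioc_eq_integral_Ioo,
      intervalIntegral.integral_of_le (by linarith)]
    refine setIntegral_congr_fun measurableSet_Ioc fun s hs => ?_
    exact (indicator_of_mem (show s ∈ Ioc 0 M.T from ⟨ht.trans_lt hs.1, hs.2.trans htε⟩) _).symm
  rw [← hmain, integral_sub h1 h2, hM.customerUtility_eq hl htT, hM.customerUtility_eq hp htT]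
  ring

theorem isEquilibrium_of_isOptimalCoverage (hM : M.Standing) (hγ : 0 < γ) (hξ : 0 ≤ ξ γ')
    (h : M.IsOptimalCoverage ξ γ γ' l) : M.IsEquilibrium ξ γ γ' l := by
  obtain ⟨hl, hae⟩ := (hM.isOptimalCoverage_iff hγ hξ).1 h
  refine ⟨hl, fun t ht x lbar hadm => ?_⟩
  have he := hM.admissible_excessOfLoss (div_nonneg hξ hγ.le)
  have hae' : ∀ᵐ z ∂(M.lossMeasure t), Function.uncurry l z = max (z.2 - ξ γ' / γ) 0 := by
    rw [hM.lossMeasure_eq_restrict ht.1]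
    exact ae_restrict_of_ae hae
  refine le_liminf_of_le (by isBoundedDefault) ?_
  filter_upwards [hadm, self_mem_nhdsWithin] with ε hε hpos
  rw [hM.customerUtility_congr hl he ht hae']
  exact_mod_cast div_nonneg (sub_nonneg.2 (hM.customerUtility_le hγ hξ hε ht)) (le_of_lt hpos)

/-- An equilibrium strategy cannot be improved by switching to the excess-of-loss coverage on a
short interval. By Lebesgue's differentiation theorem, it then loses no utility at almost any
time. -/
theorem isOptimalCoverage_of_isEquilibrium (hM : M.Standing) (hγ : 0 < γ) (hξ : 0 ≤ ξ γ')
    (h : M.IsEquilibrium ξ γ γ' l) : M.IsOptimalCoverage ξ γ γ' l := by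
  have := hM.isProbabilityMeasure_claimLaw
  obtain ⟨hl, heq⟩ := h
  have hd : 0 ≤ ξ γ' / γ := div_nonneg hξ hγ.le
  have h0T : (0 : ℝ) ∈ Icc 0 M.T := ⟨le_rfl, hM.T_pos.le⟩
  set D : ℝ → ℝ := (Ioc 0 M.T).indicator (M.costGap (ξ γ') γ l) with hD
  have hDint : LocallyIntegrable D volume :=
    ((hM.integrableOn_costGap hl hd).integrable_indicator measurableSet_Ioc).locallyIntegrable
  have hneg : ∀ᵐ t : ℝ, t ∈ Ioo 0 M.T → D t ≤ 0 := by
    filter_upwards [LocallyIntegrable.ae_hasDerivAt_integral hDint] with t hderiv ht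
    have hslope := (hasDerivAt_iff_tendsto_slope_zero.1 (hderiv t)).mono_left
      (nhdsWithin_mono (0 : ℝ) fun (ε : ℝ) (hε : ε ∈ Ioi (0 : ℝ)) => ne_of_gt hε)
    have hquot : Tendsto (fun ε => (M.customerUtility ξ γ γ' t 0 l
        - M.customerUtility ξ γ γ' t 0 (perturbed l (fun y => max (y - ξ γ' / γ) 0) t ε)) / ε)
        (𝓝[>] 0) (𝓝 (-(M.lam * D t))) := by
      refine ((hslope.const_mul M.lam).neg).congr' ?_
      filter_upwards [self_mem_nhdsWithin,
        nhdsWithin_le_nhds (Iio_mem_nhds (sub_pos.2 ht.2))] with ε hε hεT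
      rw [mem_Iio] at hεT
      rw [hM.customerUtility_sub_perturbed hl hd ht.1.le (le_of_lt hε) (by linarith),
        intervalIntegral.integral_same, sub_zero, smul_eq_mul]
      ring
    have hlim := (continuous_coe_real_ereal.tendsto _).comp hquot
    have hge := heq t ⟨ht.1.le, ht.2.le⟩ 0 _
      (Eventually.of_forall fun ε => hM.admissible_perturbed hl hd t ε)
    have hge' : 0 ≤ -(M.lam * D t) := by exact_mod_cast hge.trans_eq hlim.liminf_eq
    by_contra hpos
    rw [not_le] at hpos
    nlinarith [mul_pos hM.lam_pos hpos]
  refine (hM.isOptimalCoverage_iff hγ hξ).2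
    ⟨hl, hM.ae_eq_of_customerUtility_le (x := 0) hγ hξ hl h0T ?_⟩
  rw [← sub_nonpos, hM.customerUtility_excessOfLoss_sub hd hl h0T]
  refine mul_nonpos_of_nonneg_of_nonpos hM.lam_pos.le ?_
  have hi := hM.integrable_coverageCost_sub (θ := ξ γ') (γ := γ) hl hd le_rfl
  rw [lossMeasure] at hi ⊢
  rw [integral_prod _ hi, integral_Ioc_eq_integral_Ioo]
  refine setIntegral_nonpos_of_ae_restrict ?_
  rw [EventuallyLE, ae_restrict_iff' measurableSet_Ioo]
  filter_upwards [hneg] with t ht hmem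
  have := ht hmem
  rwa [hD, indicator_of_mem (Ioo_subset_Ioc_self hmem)] at this

end Standing

end Market

/-! ### Stop-loss transforms and the customer's value function -/

namespace Market

variable {Ω : Type*} [MeasurableSpace Ω] {M : Market Ω}

/-- The minimal expected cost, per claim, of a customer with risk aversion `γ` and loading `θ`. -/
noncomputable def expectedCost (M : Market Ω) (γ θ : ℝ) : ℝ :=
  ∫ ω, coverageCost θ γ (max (M.Y 0 ω - θ / γ) 0) (M.Y 0 ω) ∂M.P

theorem stopLoss_nonneg (M : Market Ω) (d : ℝ) : 0 ≤ M.stopLoss d :=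
  integral_nonneg fun _ => le_max_right _ _

theorem stopLossSq_nonneg (M : Market Ω) (d : ℝ) : 0 ≤ M.stopLossSq d :=
  integral_nonneg fun _ => sq_nonneg _

namespace Standing

variable {ξ : ℝ → ℝ} {γ γ' γ₁ γ₂ θ θ' d d' c : ℝ}

theorem γ_pos (hM : M.Standing) (hγ : γ ∈ Icc M.γL M.γH) : 0 < γ := hM.γL_pos.trans_le hγ.1

theorem memLp_excess (hM : M.Standing) (d : ℝ) :
    MemLp (fun ω => max (M.Y 0 ω - d) 0) 2 M.P := by
  have := hM.prob
  exact (hM.sqIntegrableY.sub (memLp_const d)).mono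
    (((hM.measurableY 0).sub_const d).max measurable_const).aestronglyMeasurable
    (ae_of_all _ fun ω => by
      rw [Real.norm_eq_abs, Real.norm_eq_abs, abs_of_nonneg (le_max_right _ _)]
      exact max_le (le_abs_self _) (abs_nonneg _))

theorem integrable_excess (hM : M.Standing) (d : ℝ) :
    Integrable (fun ω => max (M.Y 0 ω - d) 0) M.P :=
  have := hM.prob
  (hM.memLp_excess d).integrable (by norm_num)

theorem stopLoss_anti (hM : M.Standing) (h : d ≤ d') : M.stopLoss d' ≤ M.stopLoss d :=
  integral_mono (hM.integrable_excess d') (hM.integrable_excess d) fun _ =>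
    max_le_max (sub_le_sub_left h _) le_rfl

theorem abs_stopLoss_sub_le (hM : M.Standing) (d d' : ℝ) :
    |M.stopLoss d - M.stopLoss d'| ≤ |d - d'| := by
  have := hM.prob
  rw [stopLoss, stopLoss, ← integral_sub (hM.integrable_excess d) (hM.integrable_excess d')]
  have h := norm_integral_le_of_norm_le_const (μ := M.P) (C := |d - d'|)
    (f := fun ω => max (M.Y 0 ω - d) 0 - max (M.Y 0 ω - d') 0) (ae_of_all _ fun ω => by
      have := abs_max_sub_max_le_abs (M.Y 0 ω - d) (M.Y 0 ω - d') 0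
      rw [Real.norm_eq_abs]
      refine this.trans_eq ?_
      rw [sub_sub_sub_cancel_left, abs_sub_comm])
  simpa using h

theorem continuous_stopLoss (hM : M.Standing) : Continuous M.stopLoss := by
  refine (LipschitzWith.of_dist_le_mul (K := 1) fun d d' => ?_).continuous
  simpa [Real.dist_eq] using hM.abs_stopLoss_sub_le d d'

theorem ae_excess_eq_zero (hM : M.Standing) (h : M.stopLoss d = 0) :
    ∀ᵐ ω ∂M.P, max (M.Y 0 ω - d) 0 = 0 :=
  (integral_eq_zero_iff_of_nonneg (fun _ => le_max_right _ _) (hM.integrable_excess d)).1 h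

theorem stopLossSq_eq_zero (hM : M.Standing) (h : M.stopLoss d = 0) : M.stopLossSq d = 0 := by
  refine integral_eq_zero_of_ae ?_
  filter_upwards [hM.ae_excess_eq_zero h] with ω hω
  rw [hω]
  simp

theorem integrable_coverageCost_excess (hM : M.Standing) (θ γ d : ℝ) :
    Integrable (fun ω => coverageCost θ γ (max (M.Y 0 ω - d) 0) (M.Y 0 ω)) M.P :=
  have := hM.prob
  (((hM.integrable_excess d).const_mul θ).add (hM.sqIntegrableY.integrable (by norm_num))).add
    ((hM.sqIntegrableY.sub (hM.memLp_excess d)).integrable_sq.const_mul (γ / 2))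

/-- The coverage that is optimal for the loading `θ` is a competitor for the loading `θ'`. -/
theorem expectedCost_le (hM : M.Standing) (hγ : 0 < γ) (θ θ' : ℝ) :
    M.expectedCost γ θ' ≤ M.expectedCost γ θ + (θ' - θ) * M.stopLoss (θ / γ) := by
  rw [expectedCost, expectedCost, stopLoss, ← integral_const_mul,
    ← integral_add (hM.integrable_coverageCost_excess _ _ _)
      ((hM.integrable_excess _).const_mul _)]
  refine integral_mono (hM.integrable_coverageCost_excess _ _ _)
    ((hM.integrable_coverageCost_excess _ _ _).add ((hM.integrable_excess _).const_mul _))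
    fun ω => ?_
  have h := sq_le_coverageCost_sub (θ := θ') hγ
    (le_max_right (M.Y 0 ω - θ / γ) 0) (M.Y 0 ω)
  have h0 : 0 ≤ γ / 2 * (max (M.Y 0 ω - θ / γ) 0 - max (M.Y 0 ω - θ' / γ) 0) ^ 2 := by positivity
  have h1 : coverageCost θ' γ (max (M.Y 0 ω - θ / γ) 0) (M.Y 0 ω)
      = coverageCost θ γ (max (M.Y 0 ω - θ / γ) 0) (M.Y 0 ω)
        + (θ' - θ) * max (M.Y 0 ω - θ / γ) 0 := by
    unfold coverageCost
    ring
  simp only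
  linarith

theorem expectedCost_mono (hM : M.Standing) (hγ : 0 < γ) (h : θ ≤ θ') :
    M.expectedCost γ θ ≤ M.expectedCost γ θ' := by
  have h1 := hM.expectedCost_le hγ θ' θ
  nlinarith [mul_nonneg (sub_nonneg.2 h) (M.stopLoss_nonneg (θ' / γ))]

/-- The envelope theorem for the loading. -/
theorem hasDerivAt_expectedCost (hM : M.Standing) (hγ : 0 < γ) (θ : ℝ) :
    HasDerivAt (M.expectedCost γ) (M.stopLoss (θ / γ)) θ := by
  rw [hasDerivAt_iff_isLittleO]
  refine Asymptotics.IsBigO.trans_isLittleO ?_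
    (Asymptotics.isLittleO_pow_sub_sub θ (m := 2) (by norm_num))
  refine Asymptotics.IsBigO.of_bound (1 / γ) (Eventually.of_forall fun θ' => ?_)
  have h1 := hM.expectedCost_le hγ θ θ'
  have h2 := hM.expectedCost_le hγ θ' θ
  have h3 := hM.abs_stopLoss_sub_le (θ' / γ) (θ / γ)
  rw [smul_eq_mul, norm_pow, norm_norm, Real.norm_eq_abs, Real.norm_eq_abs]
  have h4 : |θ' - θ| * |M.stopLoss (θ' / γ) - M.stopLoss (θ / γ)| ≤ 1 / γ * |θ' - θ| ^ 2 := by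
    refine (mul_le_mul_of_nonneg_left h3 (abs_nonneg _)).trans_eq ?_
    rw [← sub_div, abs_div, abs_of_pos hγ]
    ring
  refine le_trans ?_ h4
  rw [← abs_mul, abs_le]
  have h5 := neg_abs_le ((θ' - θ) * (M.stopLoss (θ' / γ) - M.stopLoss (θ / γ)))
  constructor
  · nlinarith
  · nlinarith [abs_nonneg ((θ' - θ) * (M.stopLoss (θ' / γ) - M.stopLoss (θ / γ)))]

theorem customerValue_eq_expectedCost (hM : M.Standing) (hγ : 0 < γ) (hξ : 0 ≤ ξ γ') :
    M.customerValue ξ γ γ' = M.xC - M.lam * M.T * M.expectedCost γ (ξ γ') := by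
  have h0T : (0 : ℝ) ∈ Icc 0 M.T := ⟨le_rfl, hM.T_pos.le⟩
  rw [hM.customerValue_eq hγ hξ, hM.customerUtility_eq
    (hM.admissible_excessOfLoss (div_nonneg hξ hγ.le)) h0T, mul_assoc]
  have hg : Measurable fun y : ℝ => coverageCost (ξ γ') γ (max (y - ξ γ' / γ) 0) y := by
    unfold coverageCost
    fun_prop
  have := hM.integral_snd_lossMeasure hM.T_pos.le hg
  rw [sub_zero] at this
  rw [expectedCost, ← this]
  rfl

/-! ### Truth-telling and its first-order condition -/

theorem truthTelling_iff (hM : M.Standing) (hξ : M.AdmissibleLoading ξ) :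
    M.TruthTelling ξ ↔ ∀ γ ∈ Icc M.γL M.γH, ∀ γ' ∈ Icc M.γL M.γH,
      M.expectedCost γ (ξ γ) ≤ M.expectedCost γ (ξ γ') := by
  refine forall₂_congr fun γ hγ => forall₂_congr fun γ' hγ' => ?_
  have hpos := mul_pos hM.lam_pos hM.T_pos
  change M.customerValue ξ γ γ' ≤ M.customerValue ξ γ γ ↔ _
  rw [hM.customerValue_eq_expectedCost (hM.γ_pos hγ) (hξ γ hγ),
    hM.customerValue_eq_expectedCost (hM.γ_pos hγ) (hξ γ' hγ'), sub_le_sub_iff_left,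
    mul_le_mul_iff_right₀ hpos]

/-- Under truth-telling, the types that buy insurance have the smallest loading. -/
theorem loading_le_of_stopLoss_pos (hM : M.Standing) (hξ : M.AdmissibleLoading ξ)
    (h : M.TruthTelling ξ) (hγ : γ ∈ Icc M.γL M.γH) (hγ' : γ' ∈ Icc M.γL M.γH)
    (hpos : 0 < M.stopLoss (ξ γ / γ)) : ξ γ ≤ ξ γ' := by
  by_contra! hlt
  have h1 := (hM.truthTelling_iff hξ).1 h γ hγ γ' hγ'
  have h2 := hM.expectedCost_le (hM.γ_pos hγ) (ξ γ) (ξ γ')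
  nlinarith [mul_pos (sub_pos.2 hlt) hpos]

/-- A loading that a type without demand does not strictly prefer to her own loading creates no
demand either. -/
theorem stopLoss_eq_zero_of_expectedCost_le (hM : M.Standing) (hγ : 0 < γ)
    (h0 : M.stopLoss (θ / γ) = 0) (hle : M.expectedCost γ θ ≤ M.expectedCost γ c) :
    M.stopLoss (c / γ) = 0 := by
  by_contra hne
  have hpos : 0 < M.stopLoss (c / γ) := lt_of_le_of_ne (M.stopLoss_nonneg _) (Ne.symm hne)
  have hcont : Continuous fun θ => M.stopLoss (θ / γ) :=
    hM.continuous_stopLoss.comp (continuous_id.div_const γ)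
  have hev : ∀ᶠ θ in 𝓝[>] c, 0 < M.stopLoss (θ / γ) :=
    nhdsWithin_le_nhds (hcont.continuousAt.eventually (lt_mem_nhds hpos))
  obtain ⟨b, hb, hcb⟩ := (hev.and self_mem_nhdsWithin).exists
  have hbθ : b ≤ θ := by
    by_contra! hlt
    have := hM.stopLoss_anti (div_le_div_of_nonneg_right hlt.le hγ.le)
    linarith
  have h1 := hM.expectedCost_le hγ b c
  have h2 := hM.expectedCost_mono hγ hbθ
  nlinarith [mul_pos (sub_pos.2 hcb) hb]

theorem hasDerivWithinAt_customerValue (hM : M.Standing) (hξ : M.AdmissibleLoading ξ)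
    (hγ : 0 < γ) (hγ' : γ' ∈ Icc M.γL M.γH) {ξ' : ℝ}
    (h : HasDerivWithinAt ξ ξ' (Icc M.γL M.γH) γ') :
    HasDerivWithinAt (M.customerValue ξ γ)
      (-(M.lam * M.T * (M.stopLoss (ξ γ' / γ) * ξ'))) (Icc M.γL M.γH) γ' := by
  have h1 : HasDerivWithinAt (fun s => M.xC - M.lam * M.T * M.expectedCost γ (ξ s))
      (-(M.lam * M.T * (M.stopLoss (ξ γ' / γ) * ξ'))) (Icc M.γL M.γH) γ' :=
    (((hM.hasDerivAt_expectedCost hγ (ξ γ')).comp_hasDerivWithinAt γ' h).const_mul _).const_sub _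
  exact h1.congr (fun s hs => hM.customerValue_eq_expectedCost hγ (hξ s hs))
    (hM.customerValue_eq_expectedCost hγ (hξ γ' hγ'))

/-- The types that buy insurance form a relatively open set. -/
theorem eventually_stopLoss_pos (hM : M.Standing) (hc : ContinuousOn ξ (Icc M.γL M.γH))
    (hγ : γ ∈ Icc M.γL M.γH) (hpos : 0 < M.stopLoss (ξ γ / γ)) :
    ∀ᶠ s in 𝓝[Icc M.γL M.γH] γ, 0 < M.stopLoss (ξ s / s) := by
  have h : ContinuousWithinAt (fun s => M.stopLoss (ξ s / s)) (Icc M.γL M.γH) γ :=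
    hM.continuous_stopLoss.continuousAt.comp_continuousWithinAt
      ((hc γ hγ).div continuousWithinAt_id (hM.γ_pos hγ).ne')
  exact h.eventually (lt_mem_nhds hpos)

/-- At a type that buys insurance, truth-telling makes the loading locally constant; this settles
the end points, where a maximum alone does not force the one-sided derivative to vanish. -/
theorem truthTellingFOC_of_truthTelling (hM : M.Standing) (hξ : M.AdmissibleLoading ξ)
    (hd : DifferentiableOn ℝ ξ (Icc M.γL M.γH)) (h : M.TruthTelling ξ) : M.TruthTellingFOC ξ := by
  intro γ hγ
  rcases (M.stopLoss_nonneg (ξ γ / γ)).eq_or_lt with h0 | hpos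
  · have := hM.hasDerivWithinAt_customerValue hξ (hM.γ_pos hγ) hγ (hd γ hγ).hasDerivWithinAt
    simpa [← h0] using this
  · have hev : ξ =ᶠ[𝓝[Icc M.γL M.γH] γ] fun _ => ξ γ := by
      filter_upwards [hM.eventually_stopLoss_pos hd.continuousOn hγ hpos, self_mem_nhdsWithin]
        with s hs hmem
      exact le_antisymm (hM.loading_le_of_stopLoss_pos hξ h hmem hγ hs)
        (hM.loading_le_of_stopLoss_pos hξ h hγ hmem hpos)
    have hconst : HasDerivWithinAt ξ 0 (Icc M.γL M.γH) γ :=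
      (hasDerivWithinAt_const γ _ (ξ γ)).congr_of_eventuallyEq hev rfl
    simpa using hM.hasDerivWithinAt_customerValue hξ (hM.γ_pos hγ) hγ hconst

theorem derivWithin_mul_stopLoss_eq_zero (hM : M.Standing) (hξ : M.AdmissibleLoading ξ)
    (hd : DifferentiableOn ℝ ξ (Icc M.γL M.γH)) (h : M.TruthTellingFOC ξ)
    (hγ : γ ∈ Icc M.γL M.γH) :
    derivWithin ξ (Icc M.γL M.γH) γ * M.stopLoss (ξ γ / γ) = 0 := by
  rcases hM.γL_le.eq_or_lt with heq | hlt
  · have hγL : γ = M.γL := le_antisymm (heq ▸ hγ.2) hγ.1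
    rw [← heq, Icc_self, hγL, derivWithin_zero_of_not_accPt, zero_mul]
    simp only [AccPt, principal_singleton, not_neBot]
    exact disjoint_iff.1 (disjoint_of_disjoint_of_mem disjoint_compl_left self_mem_nhdsWithin
      (mem_pure.2 (mem_singleton M.γL)))
  · have h1 := hM.hasDerivWithinAt_customerValue hξ (hM.γ_pos hγ) hγ (hd γ hγ).hasDerivWithinAt
    have h2 := (uniqueDiffOn_Icc hlt γ hγ).eq_deriv _ h1 (h γ hγ)
    rw [neg_eq_zero, mul_eq_zero, or_iff_right (mul_pos hM.lam_pos hM.T_pos).ne'] at h2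
    rw [mul_comm, h2]

/-- Under the first-order condition the loading stays constant to the right of a type that buys
insurance: with a fixed loading the demand increases with the risk aversion, so that demand cannot
vanish before the loading has changed. -/
theorem loading_eq_of_le (hM : M.Standing) (hξ : M.AdmissibleLoading ξ)
    (hd : DifferentiableOn ℝ ξ (Icc M.γL M.γH)) (h : M.TruthTellingFOC ξ)
    (hγ₁ : γ₁ ∈ Icc M.γL M.γH) (hγ₂ : γ₂ ∈ Icc M.γL M.γH) (hle : γ₁ ≤ γ₂)
    (hpos : 0 < M.stopLoss (ξ γ₁ / γ₁)) : ξ γ₂ = ξ γ₁ := by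
  have hsub : Icc γ₁ γ₂ ⊆ Icc M.γL M.γH := Icc_subset_Icc hγ₁.1 hγ₂.2
  have hclosed : IsClosed ({s | ξ s = ξ γ₁} ∩ Icc γ₁ γ₂) := by
    rw [inter_comm]
    exact (hd.continuousOn.mono hsub).preimage_isClosed_of_isClosed isClosed_Icc
      (isClosed_singleton (x := ξ γ₁))
  refine hclosed.Icc_subset_of_forall_mem_nhdsWithin rfl ?_ (right_mem_Icc.2 hle)
  rintro s ⟨hs, hmem⟩
  have hs' : s ∈ Icc M.γL M.γH := hsub (Ico_subset_Icc_self hmem)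
  have hsH : s < M.γH := hmem.2.trans_le hγ₂.2
  have hspos : 0 < M.stopLoss (ξ s / s) := by
    rw [show ξ s = ξ γ₁ from hs]
    exact hpos.trans_le (hM.stopLoss_anti
      (div_le_div_of_nonneg_left (hξ γ₁ hγ₁) (hM.γ_pos hγ₁) hmem.1))
  have hIcc : Icc M.γL M.γH ∈ 𝓝[≥] s :=
    mem_of_superset (Icc_mem_nhdsGE hsH) (Icc_subset_Icc_left hs'.1)
  have hev : {r | 0 < M.stopLoss (ξ r / r)} ∩ Icc M.γL M.γH ∈ 𝓝[≥] s :=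
    inter_mem (nhdsWithin_le_of_mem hIcc (hM.eventually_stopLoss_pos hd.continuousOn hs' hspos))
      hIcc
  obtain ⟨b, hsb, hb⟩ := mem_nhdsGE_iff_exists_Icc_subset.1 hev
  have hconst := constant_of_has_deriv_right_zero (f := ξ) (a := s) (b := b)
    (hd.continuousOn.mono fun r hr => (hb hr).2) fun r hr => by
      have hr' := hb (Ico_subset_Icc_self hr)
      have hbH : b ≤ M.γH := (hb (right_mem_Icc.2 (le_of_lt hsb))).2.2
      have h0 := hM.derivWithin_mul_stopLoss_eq_zero hξ hd h hr'.2
      rw [mul_eq_zero, or_iff_left (ne_of_gt hr'.1)] at h0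
      have h1 := (hd r hr'.2).hasDerivWithinAt
      rw [h0] at h1
      exact h1.mono_of_mem_nhdsWithin (mem_of_superset (Icc_mem_nhdsGE (hr.2.trans_le hbH))
        (Icc_subset_Icc_left hr'.2.1))
  exact mem_of_superset (Icc_mem_nhdsGT hsb) fun r hr => (hconst r hr).trans hs

theorem exists_eq_loading (hM : M.Standing) (hξ : M.AdmissibleLoading ξ)
    (hd : DifferentiableOn ℝ ξ (Icc M.γL M.γH)) (h : M.TruthTellingFOC ξ) :
    ∃ c : ℝ, 0 ≤ c ∧ ∀ γ ∈ Icc M.γL M.γH, 0 < M.stopLoss (ξ γ / γ) → ξ γ = c := by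
  by_cases hbuy : ∃ γ₀ ∈ Icc M.γL M.γH, 0 < M.stopLoss (ξ γ₀ / γ₀)
  · obtain ⟨γ₀, hγ₀, h₀⟩ := hbuy
    refine ⟨ξ γ₀, hξ γ₀ hγ₀, fun γ hγ hpos => ?_⟩
    rcases le_total γ₀ γ with hle | hle
    · exact hM.loading_eq_of_le hξ hd h hγ₀ hγ hle h₀
    · exact (hM.loading_eq_of_le hξ hd h hγ hγ₀ hle hpos).symm
  · exact ⟨0, le_rfl, fun γ hγ hpos => absurd ⟨γ, hγ, hpos⟩ hbuy⟩

end Standing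

end Market

/-! ### The criterion for constant loadings -/

theorem max_sub_zero_sq_le {d : ℝ} (hd : 0 ≤ d) (y : ℝ) : max (y - d) 0 ^ 2 ≤ y ^ 2 := by
  rcases le_total (y - d) 0 with h | h
  · rw [max_eq_right h]
    nlinarith [sq_nonneg y]
  · rw [max_eq_left h]
    nlinarith

theorem mul_max_sub_zero_le {d : ℝ} (hd : 0 ≤ d) (y : ℝ) : d * max (y - d) 0 ≤ y ^ 2 := by
  rcases le_total (y - d) 0 with h | h
  · rw [max_eq_right h]
    nlinarith [sq_nonneg y]
  · rw [max_eq_left h]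
    nlinarith [sq_nonneg (y - d)]

namespace Market

variable {Ω : Type*} [MeasurableSpace Ω] {M : Market Ω}

/-- The insurer's utility, per unit of `lam * T`, from type `γ` at the constant loading `c`; its
`G`-average is `loadingCriterion`. -/
noncomputable def typeCriterion (M : Market Ω) (c γ : ℝ) : ℝ :=
  c * M.stopLoss (c / γ) - M.γI / 2 * M.stopLossSq (c / γ)

namespace Standing

variable {ξ : ℝ → ℝ} {L : ℝ → ℝ → ℝ → ℝ} {l : ℝ → ℝ → ℝ} {γ γ' c d : ℝ}

theorem measurable_excess (hM : M.Standing) (d : ℝ) :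
    Measurable fun ω => max (M.Y 0 ω - d) 0 :=
  ((hM.measurableY 0).sub_const d).max measurable_const

theorem stopLossSq_le (hM : M.Standing) (hd : 0 ≤ d) :
    M.stopLossSq d ≤ ∫ ω, M.Y 0 ω ^ 2 ∂M.P :=
  integral_mono (hM.memLp_excess d).integrable_sq hM.sqIntegrableY.integrable_sq
    fun _ => max_sub_zero_sq_le hd _

theorem mul_stopLoss_le (hM : M.Standing) (hd : 0 ≤ d) :
    d * M.stopLoss d ≤ ∫ ω, M.Y 0 ω ^ 2 ∂M.P := by
  rw [stopLoss, ← integral_const_mul]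
  exact integral_mono ((hM.integrable_excess d).const_mul d) hM.sqIntegrableY.integrable_sq
    fun ω => mul_max_sub_zero_le hd _

theorem continuousOn_stopLossSq (hM : M.Standing) : ContinuousOn M.stopLossSq (Ici 0) := by
  refine continuousOn_of_dominated (bound := fun ω => M.Y 0 ω ^ 2)
    (fun d _ => ((hM.measurable_excess d).pow_const 2).aestronglyMeasurable)
    (fun d hd => ae_of_all _ fun ω => ?_) hM.sqIntegrableY.integrable_sq
    (ae_of_all _ fun ω => by fun_prop)
  rw [Real.norm_of_nonneg (sq_nonneg _)]
  exact max_sub_zero_sq_le hd _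

theorem tendsto_mul_stopLoss (hM : M.Standing) :
    Tendsto (fun d => d * M.stopLoss d) atTop (𝓝 0) := by
  have h := tendsto_integral_filter_of_dominated_convergence (μ := M.P) (l := atTop)
    (F := fun d ω => d * max (M.Y 0 ω - d) 0) (f := fun _ => (0 : ℝ))
    (fun ω => M.Y 0 ω ^ 2)
    (Eventually.of_forall fun d => ((hM.measurable_excess d).const_mul d).aestronglyMeasurable)
    ?_ hM.sqIntegrableY.integrable_sq (ae_of_all _ fun ω => ?_)
  · simpa only [integral_const_mul, integral_zero, stopLoss] using h
  · filter_upwards [eventually_ge_atTop 0] with d hd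
    refine ae_of_all _ fun ω => ?_
    rw [Real.norm_of_nonneg (mul_nonneg hd (le_max_right _ _))]
    exact mul_max_sub_zero_le hd _
  · refine tendsto_const_nhds.congr' ?_
    filter_upwards [eventually_ge_atTop (M.Y 0 ω)] with d hd
    rw [max_eq_right (sub_nonpos.2 hd), mul_zero]

theorem tendsto_stopLossSq (hM : M.Standing) : Tendsto M.stopLossSq atTop (𝓝 0) := by
  have h := tendsto_integral_filter_of_dominated_convergence (μ := M.P) (l := atTop)
    (F := fun d ω => max (M.Y 0 ω - d) 0 ^ 2) (f := fun _ => (0 : ℝ))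
    (fun ω => M.Y 0 ω ^ 2)
    (Eventually.of_forall fun d => ((hM.measurable_excess d).pow_const 2).aestronglyMeasurable)
    ?_ hM.sqIntegrableY.integrable_sq (ae_of_all _ fun ω => ?_)
  · rwa [integral_zero] at h
  · filter_upwards [eventually_ge_atTop 0] with d hd
    refine ae_of_all _ fun ω => ?_
    rw [Real.norm_of_nonneg (sq_nonneg _)]
    exact max_sub_zero_sq_le hd _
  · refine tendsto_const_nhds.congr' ?_
    filter_upwards [eventually_ge_atTop (M.Y 0 ω)] with d hd
    rw [max_eq_right (sub_nonpos.2 hd), zero_pow two_ne_zero]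

theorem typeCriterion_eq (hγ : 0 < γ) :
    M.typeCriterion c γ = γ * (c / γ * M.stopLoss (c / γ)) - M.γI / 2 * M.stopLossSq (c / γ) := by
  rw [typeCriterion, ← mul_assoc, mul_div_cancel₀ c hγ.ne']

theorem abs_typeCriterion_le (hM : M.Standing) (hc : 0 ≤ c) (hγ : γ ∈ Icc M.γL M.γH) :
    ‖M.typeCriterion c γ‖ ≤ (M.γH + M.γI) * ∫ ω, M.Y 0 ω ^ 2 ∂M.P := by
  have hγ0 := hM.γ_pos hγ
  have hd : 0 ≤ c / γ := div_nonneg hc hγ0.le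
  have h1 := hM.mul_stopLoss_le hd
  have h2 := hM.stopLossSq_le hd
  have h3 := mul_nonneg hd (M.stopLoss_nonneg (c / γ))
  have h4 := M.stopLossSq_nonneg (c / γ)
  have hE : 0 ≤ ∫ ω, M.Y 0 ω ^ 2 ∂M.P := integral_nonneg fun _ => sq_nonneg _
  have hI := hM.γI_pos
  have h5 := mul_le_mul hγ.2 h1 h3 (hγ0.le.trans hγ.2)
  have h6 := mul_le_mul_of_nonneg_left h2 hI.le
  have h7 := mul_nonneg hγ0.le h3
  have h8 := mul_nonneg hI.le h4
  have h9 := mul_nonneg (hγ0.le.trans hγ.2) hE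
  rw [typeCriterion_eq hγ0, Real.norm_eq_abs, abs_le]
  constructor <;> nlinarith

theorem continuousOn_typeCriterion (hM : M.Standing) (hc : 0 ≤ c) :
    ContinuousOn (M.typeCriterion c) (Icc M.γL M.γH) := by
  have hdiv : ContinuousOn (fun γ => c / γ) (Icc M.γL M.γH) :=
    continuousOn_const.div continuousOn_id fun γ hγ => (hM.γ_pos hγ).ne'
  exact ((hM.continuous_stopLoss.comp_continuousOn hdiv).const_mul c).sub
    ((hM.continuousOn_stopLossSq.comp hdiv fun γ hγ =>
      div_nonneg hc (hM.γ_pos hγ).le).const_mul (M.γI / 2))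

theorem aestronglyMeasurable_typeCriterion (hM : M.Standing) (hc : 0 ≤ c) :
    AEStronglyMeasurable (M.typeCriterion c) (M.G.restrict (Icc M.γL M.γH)) :=
  (hM.continuousOn_typeCriterion hc).aestronglyMeasurable measurableSet_Icc

theorem integrableOn_typeCriterion (hM : M.Standing) (hc : 0 ≤ c) :
    IntegrableOn (M.typeCriterion c) (Icc M.γL M.γH) M.G := by
  have := hM.probG
  refine Integrable.of_bound (hM.aestronglyMeasurable_typeCriterion hc)
    ((M.γH + M.γI) * ∫ ω, M.Y 0 ω ^ 2 ∂M.P) ?_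
  exact (ae_restrict_iff' measurableSet_Icc).2
    (ae_of_all _ fun γ hγ => hM.abs_typeCriterion_le hc hγ)

theorem continuousOn_loadingCriterion (hM : M.Standing) :
    ContinuousOn M.loadingCriterion (Ici 0) := by
  have := hM.probG
  refine continuousOn_of_dominated (F := M.typeCriterion) (μ := M.G.restrict (Icc M.γL M.γH))
    (bound := fun _ => (M.γH + M.γI) * ∫ ω, M.Y 0 ω ^ 2 ∂M.P)
    (fun c hc => hM.aestronglyMeasurable_typeCriterion hc)
    (fun c hc => (ae_restrict_iff' measurableSet_Icc).2
      (ae_of_all _ fun γ hγ => hM.abs_typeCriterion_le hc hγ))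
    (integrable_const _) ((ae_restrict_iff' measurableSet_Icc).2 (ae_of_all _ fun γ hγ => ?_))
  have hdiv : ContinuousOn (fun c => c / γ) (Ici 0) := continuousOn_id.div_const γ
  exact (continuousOn_id.mul (hM.continuous_stopLoss.comp_continuousOn hdiv)).sub
    ((hM.continuousOn_stopLossSq.comp hdiv fun c hc =>
      div_nonneg hc (hM.γ_pos hγ).le).const_mul (M.γI / 2))

theorem tendsto_loadingCriterion (hM : M.Standing) :
    Tendsto M.loadingCriterion atTop (𝓝 0) := by
  have := hM.probG
  have h := tendsto_integral_filter_of_dominated_convergence (l := atTop)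
    (μ := M.G.restrict (Icc M.γL M.γH)) (F := M.typeCriterion) (f := fun _ => (0 : ℝ))
    (fun _ => (M.γH + M.γI) * ∫ ω, M.Y 0 ω ^ 2 ∂M.P)
    ?_ ?_ (integrable_const _)
    ((ae_restrict_iff' measurableSet_Icc).2 (ae_of_all _ fun γ hγ => ?_))
  · rwa [integral_zero] at h
  · filter_upwards [eventually_ge_atTop 0] with c hc
    exact hM.aestronglyMeasurable_typeCriterion hc
  · filter_upwards [eventually_ge_atTop 0] with c hc
    exact (ae_restrict_iff' measurableSet_Icc).2
      (ae_of_all _ fun γ hγ => hM.abs_typeCriterion_le hc hγ)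
  · have hγ0 := hM.γ_pos hγ
    have hdiv : Tendsto (fun c => c / γ) atTop atTop := tendsto_id.atTop_div_const hγ0
    have h1 := ((hM.tendsto_mul_stopLoss.comp hdiv).const_mul γ).sub
      ((hM.tendsto_stopLossSq.comp hdiv).const_mul (M.γI / 2))
    rw [mul_zero, mul_zero, sub_zero] at h1
    exact h1.congr fun c => (typeCriterion_eq hγ0).symm

theorem loadingCriterion_nonneg_of_isMaxOn (hM : M.Standing)
    (h : IsMaxOn M.loadingCriterion (Ici 0) c) : 0 ≤ M.loadingCriterion c := by
  refine le_of_tendsto hM.tendsto_loadingCriterion ?_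
  filter_upwards [eventually_ge_atTop 0] with x hx using h hx

theorem exists_isMaxOn_loadingCriterion_iff (hM : M.Standing) :
    (∃ c : ℝ, 0 ≤ c ∧ IsMaxOn M.loadingCriterion (Ici 0) c) ↔
      ∃ c : ℝ, 0 ≤ c ∧ 0 ≤ M.loadingCriterion c := by
  constructor
  · rintro ⟨c, hc, hmax⟩
    exact ⟨c, hc, hM.loadingCriterion_nonneg_of_isMaxOn hmax⟩
  · rintro ⟨c, hc, h0⟩
    by_cases hpos : ∃ c₁ : ℝ, 0 ≤ c₁ ∧ 0 < M.loadingCriterion c₁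
    · obtain ⟨c₁, hc₁, h₁⟩ := hpos
      obtain ⟨R, hR⟩ := eventually_atTop.1
        (hM.tendsto_loadingCriterion.eventually (gt_mem_nhds h₁))
      obtain ⟨m, hm, hmax⟩ := isCompact_Icc.exists_isMaxOn
        ⟨c₁, hc₁, le_max_right R c₁⟩ (hM.continuousOn_loadingCriterion.mono Icc_subset_Ici_self)
      refine ⟨m, hm.1, fun x hx => ?_⟩
      rcases le_total x (max R c₁) with hxR | hxR
      · exact hmax ⟨hx, hxR⟩
      · exact (hR x ((le_max_left _ _).trans hxR)).le.trans (hmax ⟨hc₁, le_max_right R c₁⟩)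
    · push Not at hpos
      exact ⟨c, hc, fun x hx => (hpos x hx).trans h0⟩

/-- Full coverage without loading leaves the insurer the risk without reward. -/
theorem loadingCriterion_zero_neg (hM : M.Standing) : M.loadingCriterion 0 < 0 := by
  have := hM.prob
  have := hM.probG
  have hB : 0 < M.stopLossSq 0 := by
    refine lt_of_le_of_ne (M.stopLossSq_nonneg 0) fun h => ?_
    have hae := (integral_eq_zero_iff_of_nonneg (fun _ => sq_nonneg _)
      (hM.memLp_excess 0).integrable_sq).1 h.symm
    obtain ⟨ω, h1, h2⟩ := (hae.and (hM.posY 0)).exists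
    simp only [Pi.zero_apply, sub_zero, max_eq_left (le_of_lt h2)] at h1
    exact (pow_pos h2 2).ne' h1
  rw [loadingCriterion, Measure.restrict_eq_self_of_ae_mem hM.suppG]
  simp only [zero_div, zero_mul, zero_sub, integral_const, probReal_univ, smul_eq_mul, one_mul]
  have := mul_pos hM.γI_pos hB
  linarith

theorem ne_zero_of_isMaxOn (hM : M.Standing) (h : IsMaxOn M.loadingCriterion (Ici 0) c) :
    c ≠ 0 := by
  rintro rfl
  exact absurd hM.loadingCriterion_zero_neg (not_lt.2 (hM.loadingCriterion_nonneg_of_isMaxOn h))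

/-! ### The insurer's problem -/

theorem meanVariance_insurerWealth (hM : M.Standing) (hγ : γ ∈ Icc M.γL M.γH) (hξ : 0 ≤ ξ γ)
    (h : M.IsOptimalCoverage ξ γ γ l) :
    meanVariance M.P M.γI (M.insurerWealth ξ γ l M.T)
      = M.lam * M.T * M.typeCriterion (ξ γ) γ := by
  obtain ⟨hl, hae⟩ := (hM.isOptimalCoverage_iff (hM.γ_pos hγ) hξ).1 h
  have h1 : ∫ z, Function.uncurry l z ∂(M.lossMeasure 0) = M.T * M.stopLoss (ξ γ / γ) := by
    rw [integral_congr_ae hae, hM.integral_snd_lossMeasure hM.T_pos.le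
      (g := fun y => max (y - ξ γ / γ) 0) (by fun_prop), sub_zero]
    rfl
  have h2 : ∫ z, Function.uncurry l z ^ 2 ∂(M.lossMeasure 0)
      = M.T * M.stopLossSq (ξ γ / γ) := by
    have hae2 : ∀ᵐ z ∂(M.lossMeasure 0), Function.uncurry l z ^ 2
        = max (z.2 - ξ γ / γ) 0 ^ 2 := by
      filter_upwards [hae] with z hz
      rw [hz]
    rw [integral_congr_ae hae2, hM.integral_snd_lossMeasure hM.T_pos.le
      (g := fun y => max (y - ξ γ / γ) 0 ^ 2) (by fun_prop), sub_zero]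
    rfl
  rw [(hM.insurer_moments hl).2, h1, h2, typeCriterion]
  ring

theorem insurerObjective_eq (hM : M.Standing) (h : M.IsFeasibleMenu ξ L) :
    M.insurerObjective ξ L
      = M.lam * M.T * ∫ γ in Icc M.γL M.γH, M.typeCriterion (ξ γ) γ ∂M.G := by
  rw [insurerObjective, ← integral_const_mul]
  exact setIntegral_congr_fun measurableSet_Icc fun γ hγ =>
    hM.meanVariance_insurerWealth hγ (h.loading γ hγ) (h.response γ hγ)

theorem isFeasibleMenu_const (hM : M.Standing) (hc : 0 ≤ c) :
    M.IsFeasibleMenu (fun _ => c) (excessOfLoss c) where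
  loading _ _ := hc
  response _ hγ := hM.isOptimalCoverage_excessOfLoss (ξ := fun _ => c) (hM.γ_pos hγ) hc
  truthful := (hM.truthTelling_iff fun _ _ => hc).2 fun _ _ _ _ => le_rfl

theorem insurerObjective_const (hM : M.Standing) (hc : 0 ≤ c) :
    M.insurerObjective (fun _ => c) (excessOfLoss c) = M.lam * M.T * M.loadingCriterion c :=
  hM.insurerObjective_eq (hM.isFeasibleMenu_const hc)

theorem typeCriterion_eq_zero (hM : M.Standing) (h : M.stopLoss (c / γ) = 0) :
    M.typeCriterion c γ = 0 := by
  rw [typeCriterion, h, hM.stopLossSq_eq_zero h]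
  ring

/-- A truth-telling menu is, for the insurer, as good as a constant loading or worth nothing. -/
theorem insurerObjective_eq_const_or_zero (hM : M.Standing) (h : M.IsFeasibleMenu ξ L) :
    (∃ c, 0 ≤ c ∧ M.insurerObjective ξ L = M.lam * M.T * M.loadingCriterion c) ∨
      M.insurerObjective ξ L = 0 := by
  rw [hM.insurerObjective_eq h]
  by_cases hbuy : ∃ γ₀ ∈ Icc M.γL M.γH, 0 < M.stopLoss (ξ γ₀ / γ₀)
  · obtain ⟨γ₀, hγ₀, h₀⟩ := hbuy
    refine Or.inl ⟨ξ γ₀, h.loading γ₀ hγ₀, ?_⟩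
    congr 1
    refine setIntegral_congr_fun measurableSet_Icc fun γ hγ => ?_
    change M.typeCriterion (ξ γ) γ = M.typeCriterion (ξ γ₀) γ
    rcases (M.stopLoss_nonneg (ξ γ / γ)).eq_or_lt with h0 | hpos
    · have hle := (hM.truthTelling_iff h.loading).1 h.truthful γ hγ γ₀ hγ₀
      rw [hM.typeCriterion_eq_zero h0.symm, hM.typeCriterion_eq_zero
        (hM.stopLoss_eq_zero_of_expectedCost_le (hM.γ_pos hγ) h0.symm hle)]
    · rw [le_antisymm (hM.loading_le_of_stopLoss_pos h.loading h.truthful hγ hγ₀ hpos)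
        (hM.loading_le_of_stopLoss_pos h.loading h.truthful hγ₀ hγ h₀)]
  · right
    rw [mul_eq_zero]
    right
    refine setIntegral_eq_zero_of_forall_eq_zero fun γ hγ => hM.typeCriterion_eq_zero ?_
    by_contra hne
    exact hbuy ⟨γ, hγ, lt_of_le_of_ne (M.stopLoss_nonneg _) (Ne.symm hne)⟩

theorem isMaxOn_iff_isOptimalMenu (hM : M.Standing) (hc : 0 ≤ c) :
    IsMaxOn M.loadingCriterion (Ici 0) c ↔ M.IsOptimalMenu (fun _ => c) (excessOfLoss c) := by
  have hpos := mul_pos hM.lam_pos hM.T_pos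
  constructor
  · refine fun hmax => ⟨hM.isFeasibleMenu_const hc, fun ξ' L' hf => ?_⟩
    rw [hM.insurerObjective_const hc]
    rcases hM.insurerObjective_eq_const_or_zero hf with ⟨c', hc', h⟩ | h
    · rw [h]
      exact mul_le_mul_of_nonneg_left (hmax hc') hpos.le
    · rw [h]
      exact mul_nonneg hpos.le (hM.loadingCriterion_nonneg_of_isMaxOn hmax)
  · intro h c' hc'
    have h1 := h.2 _ _ (hM.isFeasibleMenu_const hc')
    rw [hM.insurerObjective_const hc, hM.insurerObjective_const hc'] at h1
    exact le_of_mul_le_mul_left h1 hpos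

/-! ### Properties of the optimal menu -/

theorem premiumRate_excessOfLoss (hM : M.Standing) (c γ s : ℝ) :
    M.premiumRate (fun _ => c) γ (excessOfLoss c γ) s = (1 + c) * M.lam * M.stopLoss (c / γ) := by
  have hg : Measurable fun y : ℝ => max (y - c / γ) 0 := by fun_prop
  rw [premiumRate, stopLoss]
  congr 1
  exact integral_map (hM.measurableY 0).aemeasurable hg.aestronglyMeasurable

theorem isMaxOn_customerUtility_menu (hM : M.Standing) (hc : 0 ≤ c) (hγ : γ ∈ Icc M.γL M.γH) :
    IsMaxOn (fun γ' => M.customerUtility (fun _ => c) γ γ' 0 M.xC (excessOfLoss c γ'))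
      (Icc M.γL M.γH) γ := fun _ hγ' =>
  hM.customerUtility_le (ξ := fun _ => c) (γ' := γ) (hM.γ_pos hγ) hc
    (hM.admissible_excessOfLoss (div_nonneg hc (hM.γ_pos hγ').le)) ⟨le_rfl, hM.T_pos.le⟩

/-- By uniqueness of the optimal coverage, a tie means that two excess-of-loss coverages with
different deductibles agree almost surely, so that both vanish. -/
theorem eq_or_stopLoss_eq_zero (hM : M.Standing) (hc : 0 ≤ c) (hc0 : c ≠ 0)
    (hγ : γ ∈ Icc M.γL M.γH) (hγ' : γ' ∈ Icc M.γL M.γH)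
    (h : IsMaxOn (fun γ' => M.customerUtility (fun _ => c) γ γ' 0 M.xC (excessOfLoss c γ'))
      (Icc M.γL M.γH) γ') :
    γ' = γ ∨ (M.stopLoss (c / γ) = 0 ∧ M.stopLoss (c / γ') = 0) := by
  have := hM.isProbabilityMeasure_claimLaw
  have hγ0 := hM.γ_pos hγ
  have hγ0' := hM.γ_pos hγ'
  refine or_iff_not_imp_left.2 fun hne => ?_
  have hd : c / γ ≠ c / γ' := fun heq =>
    hne (mul_left_cancel₀ hc0 ((div_eq_div_iff hγ0.ne' hγ0'.ne').1 heq))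
  have hae := hM.ae_eq_of_customerUtility_le (ξ := fun _ => c) (γ' := γ) (x := M.xC) (t := 0) hγ0 hc
    (hM.admissible_excessOfLoss (div_nonneg hc hγ0'.le)) ⟨le_rfl, hM.T_pos.le⟩ (h hγ)
  have hne0 : NeBot (ae (volume.restrict (Ioc 0 M.T))) := by
    rw [ae_neBot, Ne, Measure.restrict_eq_zero, Real.volume_Ioc, sub_zero, ENNReal.ofReal_eq_zero,
      not_le]
    exact hM.T_pos
  obtain ⟨s, hs⟩ := (Measure.ae_ae_of_ae_prod hae).exists
  have hY : ∀ᵐ ω ∂M.P, max (M.Y 0 ω - c / γ') 0 = max (M.Y 0 ω - c / γ) 0 :=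
    ae_of_ae_map (hM.measurableY 0).aemeasurable hs
  have hzero : ∀ᵐ ω ∂M.P, max (M.Y 0 ω - c / γ') 0 = 0 := by
    filter_upwards [hY] with ω hω
    rcases le_total (M.Y 0 ω - c / γ') 0 with h1 | h1
    · exact max_eq_right h1
    rcases le_total (M.Y 0 ω - c / γ) 0 with h2 | h2
    · rw [hω, max_eq_right h2]
    · rw [max_eq_left h1, max_eq_left h2] at hω
      exact absurd (sub_right_injective hω).symm hd
  constructor
  · refine integral_eq_zero_of_ae ?_
    filter_upwards [hY, hzero] with ω h1 h2
    rw [← h1, h2, Pi.zero_apply]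
  · exact integral_eq_zero_of_ae hzero

end Standing

end Market

theorem theorem3p3 {Ω : Type*} [MeasurableSpace Ω] (M : Market Ω) (hM : M.Standing) :
    -- optimal coverages and equilibrium strategies of the customer are the same
    (∀ ξ, M.AdmissibleLoading ξ → ∀ γ ∈ Icc M.γL M.γH, ∀ γ' ∈ Icc M.γL M.γH, ∀ l,
      M.IsOptimalCoverage ξ γ γ' l ↔ M.IsEquilibrium ξ γ γ' l) ∧
    -- truth-telling, its first-order condition, and the constant loading
    (∀ ξ, M.AdmissibleLoading ξ → DifferentiableOn ℝ ξ (Icc M.γL M.γH) →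
      (M.TruthTelling ξ → M.TruthTellingFOC ξ) ∧
      (M.TruthTellingFOC ξ →
        (∀ γ ∈ Icc M.γL M.γH,
          derivWithin ξ (Icc M.γL M.γH) γ * M.stopLoss (ξ γ / γ) = 0) ∧
        ∃ c : ℝ, 0 ≤ c ∧ ∀ γ ∈ Icc M.γL M.γH, 0 < M.stopLoss (ξ γ / γ) → ξ γ = c)) ∧
    -- a maximizing loading exists iff the criterion is nonnegative somewhere
    ((∃ c : ℝ, 0 ≤ c ∧ IsMaxOn M.loadingCriterion (Ici 0) c) ↔
      ∃ c : ℝ, 0 ≤ c ∧ 0 ≤ M.loadingCriterion c) ∧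
    -- (1) the constant loading `c` is optimal for the insurer iff it maximizes the criterion
    (∀ c : ℝ, 0 ≤ c →
      (IsMaxOn M.loadingCriterion (Ici 0) c ↔
        M.IsOptimalMenu (fun _ => c) (excessOfLoss c))) ∧
    (∀ c : ℝ, 0 ≤ c → IsMaxOn M.loadingCriterion (Ici 0) c →
      -- (2) the optimal menu
      (∀ γ ∈ Icc M.γL M.γH,
        M.IsOptimalCoverage (fun _ => c) γ γ (excessOfLoss c γ) ∧
        M.IsEquilibrium (fun _ => c) γ γ (excessOfLoss c γ) ∧
        ∀ s, M.premiumRate (fun _ => c) γ (excessOfLoss c γ) s =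
          (1 + c) * M.lam * M.stopLoss (c / γ)) ∧
      -- (3) the insurer's optimal value
      ((∀ γ ∈ Icc M.γL M.γH,
          MemLp (M.insurerWealth (fun _ => c) γ (excessOfLoss c γ) M.T) 2 M.P) ∧
        IntegrableOn (fun γ => meanVariance M.P M.γI
          (M.insurerWealth (fun _ => c) γ (excessOfLoss c γ) M.T)) (Icc M.γL M.γH) M.G ∧
        M.insurerObjective (fun _ => c) (excessOfLoss c) =
          M.lam * M.T * ∫ γ in Icc M.γL M.γH,
            (c * M.stopLoss (c / γ) - M.γI / 2 * M.stopLossSq (c / γ)) ∂M.G) ∧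
      -- (4) truth-telling of the menu; ties occur only between contracts without coverage
      (∀ γ ∈ Icc M.γL M.γH,
        (∀ γ' ∈ Icc M.γL M.γH,
          MemLp (M.customerSurplus (fun _ => c) γ' (excessOfLoss c γ') 0 M.xC M.T) 2 M.P) ∧
        IsMaxOn (fun γ' => M.customerUtility (fun _ => c) γ γ' 0 M.xC (excessOfLoss c γ'))
          (Icc M.γL M.γH) γ ∧
        ∀ γ' ∈ Icc M.γL M.γH,
          IsMaxOn (fun γ' => M.customerUtility (fun _ => c) γ γ' 0 M.xC (excessOfLoss c γ'))
            (Icc M.γL M.γH) γ' →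
          γ' = γ ∨ (M.stopLoss (c / γ) = 0 ∧ M.stopLoss (c / γ') = 0))) := by
  have h0T : (0 : ℝ) ∈ Icc 0 M.T := ⟨le_rfl, hM.T_pos.le⟩
  refine ⟨fun ξ hξ γ hγ γ' hγ' l => ⟨fun h => ?_, fun h => ?_⟩, fun ξ hξ hd => ⟨fun h => ?_,
    fun h => ⟨fun γ hγ => ?_, ?_⟩⟩, hM.exists_isMaxOn_loadingCriterion_iff,
    fun c hc => hM.isMaxOn_iff_isOptimalMenu hc, fun c hc hmax => ⟨fun γ hγ => ?_, ⟨?_, ?_, ?_⟩,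
    fun γ hγ => ⟨fun γ' hγ' => ?_, hM.isMaxOn_customerUtility_menu hc hγ, fun γ' hγ' h => ?_⟩⟩⟩
  · exact hM.isEquilibrium_of_isOptimalCoverage (hM.γ_pos hγ) (hξ γ' hγ') h
  · exact hM.isOptimalCoverage_of_isEquilibrium (hM.γ_pos hγ) (hξ γ' hγ') h
  · exact hM.truthTellingFOC_of_truthTelling hξ hd h
  · exact hM.derivWithin_mul_stopLoss_eq_zero hξ hd h hγ
  · exact hM.exists_eq_loading hξ hd h
  · have hopt := (hM.isFeasibleMenu_const hc).response γ hγ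
    exact ⟨hopt, hM.isEquilibrium_of_isOptimalCoverage (hM.γ_pos hγ) hc hopt,
      hM.premiumRate_excessOfLoss c γ⟩
  · intro γ hγ
    exact (hM.insurer_moments
      (hM.admissible_excessOfLoss (div_nonneg hc (hM.γ_pos hγ).le))).1
  · refine IntegrableOn.congr_fun ((hM.integrableOn_typeCriterion hc).const_mul (M.lam * M.T))
      (fun γ hγ => ?_) measurableSet_Icc
    exact (hM.meanVariance_insurerWealth (ξ := fun _ => c) hγ hc
      ((hM.isFeasibleMenu_const hc).response γ hγ)).symm
  · exact hM.insurerObjective_const hc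
  · exact hM.memLp_customerSurplus
      (hM.admissible_excessOfLoss (div_nonneg hc (hM.γ_pos hγ').le)) h0T
  · exact hM.eq_or_stopLoss_eq_zero hc (hM.ne_zero_of_isMaxOn hmax) hγ hγ' h
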